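/- All vector spaces are real. Let $(\gamma_j)_{j\ge1}$ denote independent real-valued standard Gaussian random variables. For a Hilbert space $\mathscr H$ and a Banach space $E$, let $\gamma_\infty(\mathscr H,E)$ be the space of bounded operators $R:\mathscr H\to E$ with $$\|R\|^2:=\sup\Big\{\mathbb E\Big\|\sum_{j=1}^k\gamma_jRh_j\Big\|^2:\ (h_j)_{j=1}^k \text{ a finite orthonormal system in }\mathscr H\Big\}<\infty,$$ normed by $\|\cdot\|$, and let $\gamma(\mathscr H,E)$ be the closure of the finite rank operators in $\gamma_\infty(\mathscr H,E)$, with the same norm. A set $\mathscr T\subseteq\mathscr L(E,F)$ is $\gamma$-bounded if there is $C\ge0$ with $$\mathbb E\Big\|\sum_{j=1}^N\gamma_jT_jx_j\Big\|^2\le C^2\,\mathbb E\Big\|\sum_{j=1}^N\gamma_jx_j\Big\|^2$$ for all finite sequences $(x_j)$ in $E$ and $(T_j)$ in $\mathscr T$; the infimum of all such $C$ is denoted by $\gamma(\mathscr T)$. A function $\Phi:(a,b)\to\mathscr L(H,E)$ represents a bounded operator $R:L^2(a,b;H)\to E$ if for all $x^*\in E^*$ the function $t\mapsto\Phi^*(t)x^*$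 belongs to $L^2(a,b;H)$ and $\langle Rf,x^*\rangle=\int_a^b[f(t),\Phi^*(t)x^*]\,dt$ for all $f\in L^2(a,b;H)$; we then write $R=R_\Phi$. **Lemma.** Let $H$ be a Hilbert space, let $E$ and $F$ be Banach spaces, and let $-\infty<a<b<\infty$. Let $M_n,M:(a,b)\to\mathscr L(E,F)$ $(n\in\mathbb N)$ satisfy the following conditions: 1. for all $x\in E$ the functions $M_n(\cdot)x$ and $M(\cdot)x$ are continuously differentiable on $(a,b)$; 2. for all $x\in E$ we have $\lim_{n\to\infty}M_n(t)x=M(t)x$ and $\lim_{n\to\infty}M_n'(t)x=M'(t)x$, uniformly on compact subsets of $(a,b)$; 3. the sets $\mathscr M_n=\{M_n(t):t\in(a,b)\}$ are $\gamma$-bounded and $\sup_n\gamma(\mathscr M_n)<\infty$. Then for each $N\in\{M\}\cup\{M_n:n\in\mathbb N\}$ there is a unique bounded linear operator from $\gamma(L^2(a,b;H),E)$ to $\gamma_\infty(L^2(a,b;H),F)$, again denoted by $N$, such that $N R_\Phi=R_{N\Phi}$ for all functions $\Phi=\sum_{m=1}^kf_m\otimes(h_m\otimes x_m)$ with $f_m\in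 L^2(a,b)$, $h_m\in H$, $x_m\in E$ (that is, $\Phi(t)h=\sum_m f_m(t)[h,h_m]x_m$), where $(N\Phi)(t)=N(t)\Phi(t)$. Moreover, for all $R\in\gamma(L^2(a,b;H),E)$ we have $M_nR,\,MR\in\gamma(L^2(a,b;H),F)$ and $$\lim_{n\to\infty}M_nR=MR\quad\text{in }\gamma(L^2(a,b;H),F).$$ -/

import Mathlib

open MeasureTheory ProbabilityTheory Filter Topology Set
open scoped ENNReal NNReal InnerProductSpace

noncomputable section

/-- The law of `k` independent real standard Gaussian random variables; the coordinates
`ω j` are the Gaussian variables. -/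
def gaussianLaw (k : ℕ) : Measure (Fin k → ℝ) :=
  Measure.pi fun _ => gaussianReal 0 1

instance (k : ℕ) : IsProbabilityMeasure (gaussianLaw k) := by
  unfold gaussianLaw; infer_instance

section Gamma

variable {𝓗 : Type*} [NormedAddCommGroup 𝓗] [InnerProductSpace ℝ 𝓗]

variable {E F : Type*} [NormedAddCommGroup E] [NormedSpace ℝ E]
  [NormedAddCommGroup F] [NormedSpace ℝ F]

/-- The Gaussian norm `(𝔼 ‖∑ j, γ_j x_j‖²)^(1/2)` of a finite sequence. -/
def gaussianNorm {k : ℕ} (x : Fin k → E) : ℝ≥0∞ :=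
  eLpNorm (fun ω : Fin k → ℝ => ∑ j, ω j • x j) 2 (gaussianLaw k)

/-- `𝔼 ‖∑ γ_n T_n x_n‖² ≤ C² 𝔼 ‖∑ γ_n x_n‖²` for all finite sequences `x_n` in `E` and `T_n` in
`𝒯` (the inequality is written between the square roots). -/
def IsGammaBoundedWith (𝒯 : Set (E →L[ℝ] F)) (C : ℝ≥0) : Prop :=
  ∀ (N : ℕ) (x : Fin N → E) (T : Fin N → E →L[ℝ] F), (∀ j, T j ∈ 𝒯) →
    gaussianNorm (fun j => T j (x j)) ≤ C * gaussianNorm x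

/-- `γ`-boundedness of a family of operators. -/
def IsGammaBounded (𝒯 : Set (E →L[ℝ] F)) : Prop :=
  ∃ C : ℝ≥0, IsGammaBoundedWith 𝒯 C

/-- The `γ`-bound: the infimum of all admissible constants (`∞` if there is none). -/
def gammaBound (𝒯 : Set (E →L[ℝ] F)) : ℝ≥0∞ :=
  ⨅ (C : ℝ≥0) (_ : IsGammaBoundedWith 𝒯 C), (C : ℝ≥0∞)

lemma aestronglyMeasurable_gaussianSum {k : ℕ} (x : Fin k → E) :
    AEStronglyMeasurable (fun ω : Fin k → ℝ => ∑ j, ω j • x j) (gaussianLaw k) :=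
  Continuous.aestronglyMeasurable (by fun_prop)

lemma gaussianNorm_add_le {k : ℕ} (x y : Fin k → E) :
    gaussianNorm (fun j => x j + y j) ≤ gaussianNorm x + gaussianNorm y := by
  unfold gaussianNorm
  have h : (fun ω : Fin k → ℝ => ∑ j, ω j • (x j + y j))
      = (fun ω : Fin k → ℝ => ∑ j, ω j • x j) + fun ω : Fin k → ℝ => ∑ j, ω j • y j := by
    funext ω
    simp [smul_add, Finset.sum_add_distrib]
  rw [h]
  exact eLpNorm_add_le (aestronglyMeasurable_gaussianSum x)
    (aestronglyMeasurable_gaussianSum y) (by norm_num)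

lemma gaussianNorm_smul {k : ℕ} (c : ℝ) (x : Fin k → E) :
    gaussianNorm (fun j => c • x j) = ‖c‖ₑ * gaussianNorm x := by
  unfold gaussianNorm
  rw [← eLpNorm_const_smul]
  congr 1
  funext ω
  simp [Finset.smul_sum, smul_comm c]

lemma eq_zero_of_gaussianNorm_eq_zero (x : E) (h : gaussianNorm (fun _ : Fin 1 => x) = 0) :
    x = 0 := by
  unfold gaussianNorm at h
  rw [eLpNorm_eq_zero_iff (aestronglyMeasurable_gaussianSum _) (by norm_num)] at h
  by_contra hx
  have h1 : ∀ᵐ ω ∂(gaussianLaw 1), ω 0 = 0 := by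
    filter_upwards [h] with ω hω
    simpa [hx] using hω
  have h2 : ∀ᵐ r ∂(gaussianReal 0 1), r = 0 := by
    have hmp : MeasurePreserving (Function.eval (0 : Fin 1)) (gaussianLaw 1)
        (gaussianReal 0 1) := measurePreserving_eval (fun _ : Fin 1 => gaussianReal 0 1) 0
    rw [← hmp.map_eq]
    exact (ae_map_iff hmp.measurable.aemeasurable (measurableSet_singleton 0)).2 h1
  have : NullSingletonClass (gaussianReal 0 1) :=
    nullSingletonClass_gaussianReal one_ne_zero
  have h3 : ∀ᵐ r ∂(gaussianReal 0 1), r ≠ 0 := by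
    simp [ae_iff]
  obtain ⟨r, hr, hr'⟩ := (h2.and h3).exists
  exact hr' hr

/-- The extended `γ`-norm of an operator: the supremum of `(𝔼 ‖∑ j, γ_j R h_j‖²)^(1/2)` over all
finite orthonormal systems `h`. -/
def gammaENorm (R : 𝓗 →L[ℝ] E) : ℝ≥0∞ :=
  ⨆ (k : ℕ) (h : Fin k → 𝓗) (_ : Orthonormal ℝ h), gaussianNorm fun j => R (h j)

lemma gaussianNorm_le_gammaENorm (R : 𝓗 →L[ℝ] E) {k : ℕ} {h : Fin k → 𝓗}
    (hh : Orthonormal ℝ h) : gaussianNorm (fun j => R (h j)) ≤ gammaENorm R :=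
  le_iSup_of_le k (le_iSup_of_le h (le_iSup_of_le hh le_rfl))

lemma gammaENorm_add_le (R S : 𝓗 →L[ℝ] E) :
    gammaENorm (R + S) ≤ gammaENorm R + gammaENorm S :=
  iSup_le fun _ => iSup_le fun h => iSup_le fun hh =>
    (gaussianNorm_add_le (fun j => R (h j)) fun j => S (h j)).trans
      (add_le_add (gaussianNorm_le_gammaENorm R hh) (gaussianNorm_le_gammaENorm S hh))

lemma gammaENorm_smul (c : ℝ) (R : 𝓗 →L[ℝ] E) :
    gammaENorm (c • R) = ‖c‖ₑ * gammaENorm R := by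
  simp only [gammaENorm, ENNReal.mul_iSup, ← gaussianNorm_smul]
  rfl

lemma eq_zero_of_gammaENorm_eq_zero (R : 𝓗 →L[ℝ] E) (hR : gammaENorm R = 0) : R = 0 := by
  ext v
  by_cases hv : v = 0
  · simp [hv]
  have hu : Orthonormal ℝ fun _ : Fin 1 => (‖v‖⁻¹ • v) := by
    refine ⟨fun _ => ?_, fun i j hij => (hij (Subsingleton.elim i j)).elim⟩
    simp [norm_smul, hv]
  have h0 := le_antisymm ((gaussianNorm_le_gammaENorm R hu).trans hR.le) bot_le
  have h1 := eq_zero_of_gaussianNorm_eq_zero _ h0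
  simpa [hv] using h1

variable (𝓗 E)

/-- The linear space of `γ`-summing operators. -/
def gammaSummingSubmodule : Submodule ℝ (𝓗 →L[ℝ] E) where
  carrier := {R | gammaENorm R < ∞}
  zero_mem' := by
    have h := gammaENorm_smul (0 : ℝ) (0 : 𝓗 →L[ℝ] E)
    simp at h
    simp [h]
  add_mem' := fun hR hS => (gammaENorm_add_le _ _).trans_lt (ENNReal.add_lt_top.2 ⟨hR, hS⟩)
  smul_mem' := fun c R hR => by
    change gammaENorm (c • R) < ∞
    rw [gammaENorm_smul]
    exact ENNReal.mul_lt_top enorm_lt_top hR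

/-- The space `γ_∞(𝓗, E)` of `γ`-summing operators. It is a type of its own, since it carries
the `γ`-norm and not the operator norm. -/
def GammaSumming : Type _ := gammaSummingSubmodule 𝓗 E

instance : AddCommGroup (GammaSumming 𝓗 E) :=
  inferInstanceAs (AddCommGroup (gammaSummingSubmodule 𝓗 E))

instance : Module ℝ (GammaSumming 𝓗 E) :=
  inferInstanceAs (Module ℝ (gammaSummingSubmodule 𝓗 E))

/-- The inclusion of `γ_∞(𝓗, E)` into the bounded operators. -/
def GammaSumming.toCLM : GammaSumming 𝓗 E →ₗ[ℝ] (𝓗 →L[ℝ] E) :=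
  (gammaSummingSubmodule 𝓗 E).subtype

instance : Norm (GammaSumming 𝓗 E) :=
  ⟨fun R => (gammaENorm (GammaSumming.toCLM 𝓗 E R)).toReal⟩

lemma GammaSumming.gammaENorm_ne_top (R : GammaSumming 𝓗 E) :
    gammaENorm (GammaSumming.toCLM 𝓗 E R) ≠ ∞ :=
  ne_of_lt R.2

lemma GammaSumming.core : NormedSpace.Core ℝ (GammaSumming 𝓗 E) where
  norm_nonneg _ := ENNReal.toReal_nonneg
  norm_smul c R := by
    change (gammaENorm (GammaSumming.toCLM 𝓗 E (c • R))).toReal = _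
    rw [map_smul, gammaENorm_smul, ENNReal.toReal_mul, toReal_enorm]
    rfl
  norm_triangle R S := by
    change (gammaENorm (GammaSumming.toCLM 𝓗 E (R + S))).toReal ≤ _
    rw [map_add]
    have hR := GammaSumming.gammaENorm_ne_top 𝓗 E R
    have hS := GammaSumming.gammaENorm_ne_top 𝓗 E S
    exact (ENNReal.toReal_mono (ENNReal.add_ne_top.2 ⟨hR, hS⟩) (gammaENorm_add_le _ _)).trans
      (ENNReal.toReal_add hR hS).le
  norm_eq_zero_iff R := by
    constructor
    · intro h
      have h0 := ((ENNReal.toReal_eq_zero_iff _).1 h).resolve_right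
        (GammaSumming.gammaENorm_ne_top 𝓗 E R)
      exact Subtype.ext (eq_zero_of_gammaENorm_eq_zero _ h0)
    · rintro rfl
      change (gammaENorm (GammaSumming.toCLM 𝓗 E 0)).toReal = 0
      have h := gammaENorm_smul (0 : ℝ) (0 : 𝓗 →L[ℝ] E)
      simp at h
      simp [h]

instance : NormedAddCommGroup (GammaSumming 𝓗 E) :=
  NormedAddCommGroup.ofCore (GammaSumming.core 𝓗 E)

instance : NormedSpace ℝ (GammaSumming 𝓗 E) :=
  NormedSpace.ofCore (GammaSumming.core 𝓗 E)

/-- The finite rank operators, as a subspace of `γ_∞(𝓗, E)`. -/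
def finiteRankOperators : Submodule ℝ (GammaSumming 𝓗 E) where
  carrier := {R | FiniteDimensional ℝ (GammaSumming.toCLM 𝓗 E R).range}
  zero_mem' := by
    change FiniteDimensional ℝ (GammaSumming.toCLM 𝓗 E 0).range
    rw [map_zero, ContinuousLinearMap.toLinearMap_zero, LinearMap.range_zero]
    infer_instance
  add_mem' := fun {R S} hR hS => by
    change FiniteDimensional ℝ (GammaSumming.toCLM 𝓗 E R).range at hR
    change FiniteDimensional ℝ (GammaSumming.toCLM 𝓗 E S).range at hS
    change FiniteDimensional ℝ (GammaSumming.toCLM 𝓗 E (R + S)).range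
    rw [map_add]
    refine Submodule.finiteDimensional_of_le
      (S₂ := (GammaSumming.toCLM 𝓗 E R).range ⊔ (GammaSumming.toCLM 𝓗 E S).range) ?_
    rintro _ ⟨v, rfl⟩
    exact Submodule.add_mem_sup ⟨v, rfl⟩ ⟨v, rfl⟩
  smul_mem' := fun c R hR => by
    change FiniteDimensional ℝ (GammaSumming.toCLM 𝓗 E R).range at hR
    change FiniteDimensional ℝ (GammaSumming.toCLM 𝓗 E (c • R)).range
    rw [map_smul]
    refine Submodule.finiteDimensional_of_le (S₂ := (GammaSumming.toCLM 𝓗 E R).range) ?_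
    rintro _ ⟨v, rfl⟩
    exact Submodule.smul_mem _ c ⟨v, rfl⟩

/-- The space `γ(𝓗, E)` of `γ`-radonifying operators: the closure of the finite rank operators in
the `γ`-norm, as a subspace of `γ_∞(𝓗, E)`, with the same norm. -/
def gammaRadonifying : Submodule ℝ (GammaSumming 𝓗 E) :=
  (finiteRankOperators 𝓗 E).topologicalClosure

end Gamma

section Representation

variable {H E F : Type*} [NormedAddCommGroup H] [InnerProductSpace ℝ H] [CompleteSpace H]
  [NormedAddCommGroup E] [NormedSpace ℝ E] [NormedAddCommGroup F] [NormedSpace ℝ F]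

/-- The vector `Φ* x*` in `H`, for `Φ : H → E` and `x*` in the dual of `E` (with `H` identified
with its dual). -/
def adjointVector (Φ : H →L[ℝ] E) (φ : E →L[ℝ] ℝ) : H :=
  (InnerProductSpace.toDual ℝ H).symm (φ.comp Φ)

/-- `Φ : X → L(H, E)` represents the bounded operator `R : L²(X, μ; H) → E`. -/
def Represents {X : Type*} [MeasurableSpace X] (μ : Measure X) (Φ : X → H →L[ℝ] E)
    (R : Lp H 2 μ →L[ℝ] E) : Prop :=
  (∀ φ : E →L[ℝ] ℝ, MemLp (fun t => adjointVector (Φ t) φ) 2 μ) ∧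
  ∀ (f : Lp H 2 μ) (φ : E →L[ℝ] ℝ), φ (R f) = ∫ t, ⟪f t, adjointVector (Φ t) φ⟫_ℝ ∂μ

/-- The function `∑ m, f_m ⊗ (h_m ⊗ x_m)`, that is, `t ↦ (h ↦ ∑ m, f_m(t) [h_m, h] x_m)`. -/
def elementaryFunction {N : ℕ} (f : Fin N → ℝ → ℝ) (h : Fin N → H) (x : Fin N → E) :
    ℝ → H →L[ℝ] E :=
  fun t => ∑ m, f m t • (innerSL ℝ (h m)).smulRight (x m)

/-- `L²(a, b; H)`. -/
abbrev L2Interval (a b : ℝ) (H : Type*) [NormedAddCommGroup H] : Type _ :=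
  Lp H 2 (volume.restrict (Ioo a b))

/-- The bounded operator `T : γ(L²(a,b;H), E) → γ_∞(L²(a,b;H), F)` is an extension of the mapping
`R_Φ ↦ R_{MΦ}`, where `Φ = ∑ m, f_m ⊗ (h_m ⊗ x_m)` with `f_m ∈ L²(a,b)`. -/
def IsMultiplicationOperator (a b : ℝ) (M : ℝ → E →L[ℝ] F)
    (T : gammaRadonifying (L2Interval a b H) E →L[ℝ] GammaSumming (L2Interval a b H) F) : Prop :=
  ∀ (N : ℕ) (f : Fin N → ℝ → ℝ) (h : Fin N → H) (x : Fin N → E),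
    (∀ m, MemLp (f m) 2 (volume.restrict (Ioo a b))) →
    ∀ R : gammaRadonifying (L2Interval a b H) E,
      Represents (volume.restrict (Ioo a b)) (elementaryFunction f h x)
        (GammaSumming.toCLM _ _ (R : GammaSumming (L2Interval a b H) E)) →
      Represents (volume.restrict (Ioo a b)) (fun t => (M t).comp (elementaryFunction f h x t))
        (GammaSumming.toCLM _ _ (T R))

end Representation

end

/-! ### Gaussian sums: rotation invariance and domination. -/

section Gaussian

variable {𝓗 E F : Type*} [NormedAddCommGroup 𝓗] [InnerProductSpace ℝ 𝓗]
  [NormedAddCommGroup E] [NormedSpace ℝ E] [NormedAddCommGroup F] [NormedSpace ℝ F]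

/-! The core is a multiplier theorem: if `N` is strongly continuous and `N '' Ioo a b` is
`γ`-bounded with constant `C`, then multiplication by `N` has norm at most `C` from `γ` to `γ_∞`.
For a step function, enlarge a given finite orthonormal system in `L²(a,b;H)` to one whose span
contains it and each of whose members lives on a single step. By domination
(`gaussianNorm_le_of_mem_span`) this does not decrease the Gaussian norm, and on each new vector the
operator acts through one value of `N`, so `γ`-boundedness applies directly
(`gammaENorm_sum_comp_le`). A general `N` is sampled along simple functions tending to the identity.
The step multipliers are uniformly bounded and converge on rank one operators, hence at every `R`,
but only after evaluation at each vector; Fatou's lemma therefore puts the limit in `γ_∞` only.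

Differentiability brings the values back into `γ`. If `f` is supported in `[c, d] ⊆ (a, b)` and `m`
is `C¹`, then `f ⊗ m = f ⊗ m(c) + ∫_c^d (1_{[s,∞)} f) ⊗ m'(s) ds`. This is a Bochner integral of
rank one operators in `γ`, with norm controlled by `‖m c‖` and the supremum of `‖m'‖` on `[c, d]`
(`exists_gammaRadonifying_of_contDiffOn`). With `m = N(·)x` it gives membership in `γ`; with `m = (M
n - M₀)(·)x` and locally uniform convergence of functions and derivatives, it gives convergence for
compactly supported `f`. Density and the uniform bounds extend both conclusions to all of `γ`. -/

lemma eLpNorm_gaussianLaw_sum_mul {k : ℕ} (c : Fin k → ℝ) :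
    eLpNorm (fun ω : Fin k → ℝ => ∑ j, ω j * c j) 2 (gaussianLaw k)
      = ENNReal.ofReal √(∑ j, c j ^ 2) := by
  have hmem : ∀ j, MemLp (fun ω : Fin k → ℝ => ω j * c j) 2 (gaussianLaw k) := fun j => by
    have hmp : MeasurePreserving (Function.eval j) (gaussianLaw k) (gaussianReal 0 1) :=
      measurePreserving_eval (fun _ : Fin k => gaussianReal 0 1) j
    have h := (IsGaussian.memLp_two_id (μ := gaussianReal 0 1)).comp_measurePreserving hmp
    exact h.mul_const (c j)
  have hint : ∫ ω, ∑ j, ω j * c j ∂(gaussianLaw k) = 0 := by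
    rw [integral_finsetSum _ fun j _ => (hmem j).integrable (by norm_num)]
    refine Finset.sum_eq_zero fun j _ => ?_
    rw [integral_mul_const]
    have : ∫ ω : Fin k → ℝ, ω j ∂(gaussianLaw k) = 0 := by
      unfold gaussianLaw
      rw [integral_eval]
      simp
    rw [this, zero_mul]
  have hvar : variance (fun ω : Fin k → ℝ => ∑ j, ω j * c j) (gaussianLaw k) = ∑ j, c j ^ 2 := by
    have h := variance_sum_pi (μ := fun _ : Fin k => gaussianReal 0 1)
      (X := fun j (t : ℝ) => c j * t) fun j => IsGaussian.memLp_two_id.const_mul _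
    have h2 : (fun ω : Fin k → ℝ => ∑ j, ω j * c j)
        = ∑ j, fun ω : Fin k → ℝ => c j * ω j := by
      ext ω; simp [mul_comm]
    rw [h2]
    refine h.trans (Finset.sum_congr rfl fun j _ => ?_)
    have h3 := variance_const_mul (c j) id (gaussianReal 0 1)
    simpa using h3
  have hsum : MemLp (fun ω : Fin k → ℝ => ∑ j, ω j * c j) 2 (gaussianLaw k) :=
    memLp_finsetSum _ fun j _ => hmem j
  have he := hsum.ofReal_variance_eq
  simp only [evariance, hvar, hint, sub_zero] at he
  have h2 := eLpNorm_nnreal_pow_eq_lintegral (p := 2) (μ := gaussianLaw k)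
    (f := fun ω : Fin k → ℝ => ∑ j, ω j * c j) two_ne_zero
  norm_num at h2
  rw [← he, ← Real.sq_sqrt (Finset.sum_nonneg fun j _ => sq_nonneg (c j)),
    ENNReal.ofReal_pow (Real.sqrt_nonneg _)] at h2
  exact (ENNReal.pow_right_strictMono two_ne_zero).injective h2

lemma gaussianNorm_smul_const {k : ℕ} (c : Fin k → ℝ) (x : E) :
    gaussianNorm (fun j => c j • x) = ENNReal.ofReal (√(∑ j, c j ^ 2)) * ‖x‖ₑ := by
  rw [← eLpNorm_gaussianLaw_sum_mul]
  unfold gaussianNorm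
  rw [← eLpNorm_norm, mul_comm, ← enorm_norm x, ← eLpNorm_const_smul]
  refine eLpNorm_congr_norm_ae (ae_of_all _ fun ω => ?_)
  simp [smul_smul, ← Finset.sum_smul, norm_smul, mul_comm]

lemma gaussianNorm_single (x : E) : gaussianNorm (fun _ : Fin 1 => x) = ‖x‖ₑ := by
  simpa using gaussianNorm_smul_const (fun _ : Fin 1 => (1 : ℝ)) x

/-- Fatou's lemma for Gaussian norms. -/
lemma gaussianNorm_le_liminf {k : ℕ} {x : ℕ → Fin k → E} {y : Fin k → E}
    (h : ∀ j, Tendsto (fun n => x n j) atTop (𝓝 (y j))) :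
    gaussianNorm y ≤ atTop.liminf fun n => gaussianNorm (x n) :=
  Lp.eLpNorm_lim_le_liminf_eLpNorm (fun n => aestronglyMeasurable_gaussianSum (x n)) _
    (ae_of_all _ fun ω => tendsto_finsetSum _ fun j _ => (h j).const_smul (ω j))

lemma gaussianNorm_le_of_tendsto {k : ℕ} {x : ℕ → Fin k → E} {y : Fin k → E} {B : ℝ≥0∞}
    (h : ∀ j, Tendsto (fun n => x n j) atTop (𝓝 (y j)))
    (hB : ∀ᶠ n in atTop, gaussianNorm (x n) ≤ B) : gaussianNorm y ≤ B :=
  (gaussianNorm_le_liminf h).trans (Filter.liminf_le_of_frequently_le' hB.frequently)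

lemma measurePreserving_gaussianLaw_comp {k n : ℕ} {f : Fin k → Fin n}
    (hf : Function.Injective f) :
    MeasurePreserving (fun (ω : Fin n → ℝ) j => ω (f j)) (gaussianLaw n) (gaussianLaw k) := by
  refine ⟨by fun_prop, ?_⟩
  have h : iIndepFun (fun (i : Fin n) (ω : Fin n → ℝ) => ω i) (gaussianLaw n) :=
    iIndepFun_pi (X := fun _ => id) (fun _ => aemeasurable_id)
  rw [(iIndepFun_iff_map_fun_eq_pi_map (fun j => (measurable_pi_apply _).aemeasurable)).1
    (h.precomp hf)]
  unfold gaussianLaw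
  congr 1
  funext j
  exact (measurePreserving_eval (fun _ : Fin n => gaussianReal 0 1) (f j)).map_eq

/-- Part of an independent standard Gaussian family is again such a family, so selecting indices
amounts to putting zero vectors at the others. -/
lemma gaussianNorm_comp_injective {k n : ℕ} {f : Fin k → Fin n} (hf : Function.Injective f)
    (x : Fin n → E) :
    gaussianNorm (fun j => x (f j)) = gaussianNorm ((range f).indicator x) := by
  classical
  unfold gaussianNorm
  rw [← eLpNorm_comp_measurePreserving (aestronglyMeasurable_gaussianSum _)
    (measurePreserving_gaussianLaw_comp hf)]
  congr 1
  funext ω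
  have : ∀ i, ω i • (range f).indicator x i = (range f).indicator (fun i => ω i • x i) i := by
    intro i
    by_cases hi : i ∈ range f <;> simp [hi]
  simp_rw [this]
  have h2 := Finset.sum_image (s := Finset.univ) (g := f) (f := fun i => ω i • x i)
    (fun a _ b _ hab => hf hab)
  simp only [Function.comp_apply]
  rw [← h2, ← Finset.sum_indicator_subset _ (Finset.subset_univ (Finset.univ.image f))]
  simp

/-- This is rotation invariance: the right-hand side does not mention the basis. -/
lemma gaussianNorm_orthonormalBasis {W : Type*} [NormedAddCommGroup W] [InnerProductSpace ℝ W]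
    [FiniteDimensional ℝ W] [MeasurableSpace W] [BorelSpace W] {n : ℕ}
    (b : OrthonormalBasis (Fin n) ℝ W) (S : W →L[ℝ] E) :
    gaussianNorm (fun j => S (b j)) = eLpNorm S 2 (stdGaussian W) := by
  rw [stdGaussian_eq_map_pi_orthonormalBasis b,
    eLpNorm_map_measure S.continuous.aestronglyMeasurable (Continuous.aemeasurable (by fun_prop))]
  unfold gaussianNorm gaussianLaw
  congr 1
  funext ω
  simp

lemma gaussianNorm_eq_of_orthonormalBasis {W : Type*} [NormedAddCommGroup W]
    [InnerProductSpace ℝ W] [FiniteDimensional ℝ W] {n : ℕ}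
    (b b' : OrthonormalBasis (Fin n) ℝ W) (S : W →L[ℝ] E) :
    gaussianNorm (fun j => S (b j)) = gaussianNorm (fun j => S (b' j)) := by
  borelize W
  rw [gaussianNorm_orthonormalBasis, gaussianNorm_orthonormalBasis]

/-- The restricted family is the average of `x` and of `x` with signs flipped off `s`. Flipping
signs is an orthogonal change of basis, so both families have the same Gaussian norm. -/
lemma gaussianNorm_indicator_le {n : ℕ} (s : Set (Fin n)) (x : Fin n → E) :
    gaussianNorm (s.indicator x) ≤ gaussianNorm x := by
  classical
  let b := EuclideanSpace.basisFun (Fin n) ℝ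
  let ε : Fin n → ℝ := fun i => if i ∈ s then 1 else -1
  have hε : ∀ i, ‖ε i‖ = 1 := fun i => by by_cases hi : i ∈ s <;> simp [ε, hi]
  let S : EuclideanSpace ℝ (Fin n) →L[ℝ] E :=
    ∑ i, (EuclideanSpace.proj i : EuclideanSpace ℝ (Fin n) →L[ℝ] ℝ).smulRight (x i)
  have hS : ∀ i, S (b i) = x i := fun i => by
    simp [S, b]
  have hb' : Orthonormal ℝ fun i => ε i • b i := by
    refine ⟨fun i => ?_, fun i j hij => ?_⟩
    · simp [norm_smul, hε]
    · simp [inner_smul_left, inner_smul_right, b.orthonormal.2 hij]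
  have hsp : ⊤ ≤ Submodule.span ℝ (range fun i => ε i • b i) := by
    rw [← b.toBasis.span_eq, Submodule.span_le]
    rintro _ ⟨i, rfl⟩
    have : b i = ε i • (ε i • b i) := by
      rw [smul_smul]
      by_cases hi : i ∈ s <;> simp [ε, hi]
    rw [OrthonormalBasis.coe_toBasis, this]
    exact Submodule.smul_mem _ _ (Submodule.subset_span ⟨i, rfl⟩)
  have h := gaussianNorm_eq_of_orthonormalBasis b (OrthonormalBasis.mk hb' hsp) S
  simp only [OrthonormalBasis.coe_mk, map_smul, hS] at h
  have h1 : s.indicator x = fun i => (2⁻¹ : ℝ) • (x i + ε i • x i) := by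
    funext i
    by_cases hi : i ∈ s
    · simp [ε, hi, ← two_smul ℝ (x i), smul_smul]
    · simp [ε, hi]
  rw [h1, gaussianNorm_smul]
  calc _ ≤ ‖(2⁻¹ : ℝ)‖ₑ * (gaussianNorm x + gaussianNorm fun i => ε i • x i) := by
        gcongr; exact gaussianNorm_add_le _ _
    _ = ‖(2⁻¹ : ℝ)‖ₑ * ‖(2 : ℝ)‖ₑ * gaussianNorm x := by
        rw [← h, ← two_mul, mul_assoc, Real.enorm_eq_ofReal (zero_le_two (α := ℝ))]; simp
    _ = gaussianNorm x := by rw [← enorm_mul]; simp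

/-- Domination of Gaussian sums. -/
lemma gaussianNorm_le_of_mem_span {k n : ℕ} {g : Fin k → 𝓗} {e : Fin n → 𝓗}
    (hg : Orthonormal ℝ g) (he : Orthonormal ℝ e)
    (hge : ∀ j, g j ∈ Submodule.span ℝ (range e)) (S : 𝓗 →L[ℝ] E) :
    gaussianNorm (fun j => S (g j)) ≤ gaussianNorm (fun j => S (e j)) := by
  set W := Submodule.span ℝ (range e) with hW
  have : FiniteDimensional ℝ W := FiniteDimensional.span_of_finite ℝ (finite_range e)
  let e' : Fin n → W := fun i => ⟨e i, Submodule.subset_span ⟨i, rfl⟩⟩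
  let g' : Fin k → W := fun i => ⟨g i, hge i⟩
  have he' : Orthonormal ℝ e' := he.codRestrict W _
  have hg' : Orthonormal ℝ g' := hg.codRestrict W _
  have hsp : ⊤ ≤ Submodule.span ℝ (range e') := by
    have := Submodule.span_span_coe_preimage (R := ℝ) (s := range e)
    rw [← this]
    refine Submodule.span_mono ?_
    rintro ⟨_, hx⟩ ⟨i, rfl⟩
    exact ⟨i, rfl⟩
  let b := OrthonormalBasis.mk he' hsp
  have hdim : Module.finrank ℝ W = n := by
    simpa using Module.finrank_eq_card_basis b.toBasis
  have hkn : k ≤ n := by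
    simpa [hdim] using hg'.linearIndependent.fintype_card_le_finrank
  let ι := Fin.castLE hkn
  have hι : Function.Injective ι := Fin.castLE_injective hkn
  -- The zeros off the range of `ι` are placeholders: only the values on the range are kept when
  -- `g'` is completed to an orthonormal basis.
  let v : Fin n → W := Function.extend ι g' 0
  have hv : Orthonormal ℝ ((range ι).domRestrict v) := by
    have hf : Function.Injective fun y : range ι => y.2.choose := fun y z hyz =>
      Subtype.ext (by rw [← y.2.choose_spec, ← z.2.choose_spec]; exact congrArg ι hyz)
    convert hg'.comp _ hf using 1
    funext y
    have h := hι.extend_apply g' 0 y.2.choose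
    rwa [y.2.choose_spec] at h
  obtain ⟨b', hb'⟩ := hv.exists_orthonormalBasis_extension_of_card_eq
    (by simpa using hdim) (v := v)
  have hbg : ∀ j, b' (ι j) = g' j := fun j => by
    rw [hb' _ ⟨j, rfl⟩]; exact hι.extend_apply _ _ _
  have h1 := gaussianNorm_comp_injective hι fun i => S (b' i : 𝓗)
  simp only [hbg] at h1
  calc gaussianNorm (fun j => S (g j)) = _ := h1
    _ ≤ gaussianNorm fun i => S (b' i : 𝓗) := gaussianNorm_indicator_le _ _
    _ = gaussianNorm fun i => S (b i : 𝓗) :=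
      gaussianNorm_eq_of_orthonormalBasis b' b (S.comp W.subtypeL)
    _ = _ := by simp [b, e']

end Gaussian

/-! ### The spaces `γ_∞` and `γ`, rank one operators, and `γ`-bounded families. -/

section GammaSpace

variable {𝓗 E F : Type*} [NormedAddCommGroup 𝓗] [InnerProductSpace ℝ 𝓗]
  [NormedAddCommGroup E] [NormedSpace ℝ E] [NormedAddCommGroup F] [NormedSpace ℝ F]

lemma gammaENorm_le_of_tendsto {S : ℕ → 𝓗 →L[ℝ] E} {R : 𝓗 →L[ℝ] E} {B : ℝ≥0∞}
    (h : ∀ u, Tendsto (fun n => S n u) atTop (𝓝 (R u)))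
    (hB : ∀ᶠ n in atTop, gammaENorm (S n) ≤ B) : gammaENorm R ≤ B :=
  iSup_le fun _ => iSup_le fun g => iSup_le fun hg =>
    gaussianNorm_le_of_tendsto (fun j => h (g j))
      (hB.mono fun n hn => (gaussianNorm_le_gammaENorm (S n) hg).trans hn)

lemma enorm_apply_le_gammaENorm (R : 𝓗 →L[ℝ] E) (u : 𝓗) : ‖R u‖ₑ ≤ gammaENorm R * ‖u‖ₑ := by
  by_cases hu : u = 0
  · simp [hu]
  have ho : Orthonormal ℝ fun _ : Fin 1 => (‖u‖⁻¹ • u) := by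
    refine ⟨fun _ => ?_, fun i j hij => (hij (Subsingleton.elim i j)).elim⟩
    simp [norm_smul, hu]
  have h := gaussianNorm_le_gammaENorm R ho
  rw [gaussianNorm_single] at h
  have h2 : R u = ‖u‖ • R (‖u‖⁻¹ • u) := by
    rw [← map_smul, smul_smul, mul_inv_cancel₀ (norm_ne_zero_iff.2 hu), one_smul]
  rw [h2, enorm_smul, enorm_norm, mul_comm]
  gcongr

namespace GammaSumming

lemma ofReal_norm_eq_gammaENorm (R : GammaSumming 𝓗 E) :
    ENNReal.ofReal ‖R‖ = gammaENorm (toCLM 𝓗 E R) :=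
  ENNReal.ofReal_toReal (gammaENorm_ne_top 𝓗 E R)

lemma norm_le_iff {R : GammaSumming 𝓗 E} {c : ℝ} (hc : 0 ≤ c) :
    ‖R‖ ≤ c ↔ gammaENorm (toCLM 𝓗 E R) ≤ ENNReal.ofReal c := by
  rw [← ofReal_norm_eq_gammaENorm, ENNReal.ofReal_le_ofReal_iff hc]

lemma norm_apply_le (R : GammaSumming 𝓗 E) (u : 𝓗) : ‖toCLM 𝓗 E R u‖ ≤ ‖R‖ * ‖u‖ := by
  have h := enorm_apply_le_gammaENorm (toCLM 𝓗 E R) u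
  rwa [← ofReal_norm_eq_gammaENorm, ← ofReal_norm, ← ofReal_norm,
    ← ENNReal.ofReal_mul (norm_nonneg _), ENNReal.ofReal_le_ofReal_iff (by positivity)] at h

/-- A bounded operator of finite `γ`-norm, as an element of `γ_∞(𝓗, E)`. -/
def mk (R : 𝓗 →L[ℝ] E) (h : gammaENorm R < ∞) : GammaSumming 𝓗 E := ⟨R, h⟩

@[simp] lemma toCLM_mk (R : 𝓗 →L[ℝ] E) (h : gammaENorm R < ∞) : toCLM 𝓗 E (mk R h) = R := rfl

lemma toCLM_injective : Function.Injective (toCLM 𝓗 E) := Subtype.val_injective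

variable (E) in
/-- Evaluation at a vector, as a bounded operator on `γ_∞(𝓗, E)`. -/
noncomputable def eval (u : 𝓗) : GammaSumming 𝓗 E →L[ℝ] E :=
  LinearMap.mkContinuous
    { toFun := fun R => toCLM 𝓗 E R u
      map_add' := fun R S => by simp
      map_smul' := fun c R => by simp } ‖u‖
    fun R => by rw [mul_comm]; exact norm_apply_le R u

@[simp] lemma eval_apply (u : 𝓗) (R : GammaSumming 𝓗 E) : eval E u R = toCLM 𝓗 E R u := rfl

lemma ext_apply {R S : GammaSumming 𝓗 E} (h : ∀ u, toCLM 𝓗 E R u = toCLM 𝓗 E S u) : R = S :=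
  toCLM_injective (ContinuousLinearMap.ext h)

/-- The `γ`-norm dominates the operator norm, which supplies a limit; its lower semicontinuity under
pointwise convergence (Fatou) then gives convergence in the `γ`-norm. -/
instance [CompleteSpace E] : CompleteSpace (GammaSumming 𝓗 E) := by
  refine Metric.complete_of_cauchySeq_tendsto fun R hR => ?_
  let J : GammaSumming 𝓗 E →L[ℝ] (𝓗 →L[ℝ] E) := (toCLM 𝓗 E).mkContinuous 1 fun S => by
    rw [one_mul]
    exact ContinuousLinearMap.opNorm_le_bound _ (norm_nonneg _) (norm_apply_le S)
  obtain ⟨S, hS⟩ := cauchySeq_tendsto_of_complete (J.uniformContinuous.comp_cauchySeq hR)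
  have key : ∀ ε > 0, ∃ N, ∀ n ≥ N,
      gammaENorm (toCLM 𝓗 E (R n) - S) ≤ ENNReal.ofReal ε := fun ε hε => by
    obtain ⟨N, hN⟩ := Metric.cauchySeq_iff.1 hR ε hε
    refine ⟨N, fun n hn => gammaENorm_le_of_tendsto (S := fun m => toCLM 𝓗 E (R n - R m))
      (fun u => ?_) ?_⟩
    · have h1 : Tendsto (fun m => toCLM 𝓗 E (R m) u) atTop (𝓝 (S u)) :=
        ((ContinuousLinearMap.apply ℝ E u).continuous.tendsto S).comp hS
      simpa using tendsto_const_nhds.sub h1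
    · filter_upwards [eventually_ge_atTop N] with m hm
      rw [← norm_le_iff hε.le, ← dist_eq_norm]
      exact (hN n hn m hm).le
  have hfin : gammaENorm S < ∞ := by
    obtain ⟨N, hN⟩ := key 1 one_pos
    have h1 : S = toCLM 𝓗 E (R N) + (-1 : ℝ) • (toCLM 𝓗 E (R N) - S) := by simp
    rw [h1]
    refine (gammaENorm_add_le _ _).trans_lt (ENNReal.add_lt_top.2
      ⟨(gammaENorm_ne_top 𝓗 E _).lt_top, ?_⟩)
    rw [gammaENorm_smul]
    exact ENNReal.mul_lt_top enorm_lt_top ((hN N le_rfl).trans_lt ENNReal.ofReal_lt_top)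
  refine ⟨mk S hfin, Metric.tendsto_atTop.2 fun ε hε => ?_⟩
  obtain ⟨N, hN⟩ := key (ε / 2) (half_pos hε)
  refine ⟨N, fun n hn => ?_⟩
  have h2 : ‖R n - mk S hfin‖ ≤ ε / 2 := by
    rw [norm_le_iff (half_pos hε).le, map_sub, toCLM_mk]
    exact hN n hn
  rw [dist_eq_norm]
  linarith

end GammaSumming

/-- All the vectors are multiples of `x`, so this reduces to Bessel's inequality. -/
lemma gammaENorm_rankOne_le (g : 𝓗) (x : E) :
    gammaENorm ((innerSL ℝ g).smulRight x) ≤ ENNReal.ofReal (‖g‖ * ‖x‖) := by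
  refine iSup_le fun k => iSup_le fun h => iSup_le fun hh => ?_
  simp only [ContinuousLinearMap.smulRight_apply, innerSL_apply_apply]
  rw [gaussianNorm_smul_const, ENNReal.ofReal_mul (norm_nonneg _), ofReal_norm x]
  gcongr
  refine Real.sqrt_le_iff.2 ⟨norm_nonneg _, ?_⟩
  have hb := hh.sum_inner_products_le g (s := Finset.univ)
  refine le_trans (le_of_eq (Finset.sum_congr rfl fun j _ => ?_)) hb
  rw [real_inner_comm, Real.norm_eq_abs, sq_abs]

lemma mem_gammaRadonifying_of_finiteRank {R : GammaSumming 𝓗 E}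
    (hR : FiniteDimensional ℝ (GammaSumming.toCLM 𝓗 E R).range) : R ∈ gammaRadonifying 𝓗 E :=
  (finiteRankOperators 𝓗 E).le_topologicalClosure hR

lemma isClosed_gammaRadonifying :
    IsClosed (gammaRadonifying 𝓗 E : Set (GammaSumming 𝓗 E)) :=
  Submodule.isClosed_topologicalClosure _

instance [CompleteSpace E] : CompleteSpace (gammaRadonifying 𝓗 E) :=
  isClosed_gammaRadonifying.completeSpace_coe

/-- The rank one operator `u ↦ ⟪g, u⟫ x`, as an element of `γ(𝓗, E)`. -/
noncomputable def rankOneAux (g : 𝓗) (x : E) : gammaRadonifying 𝓗 E :=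
  ⟨GammaSumming.mk ((innerSL ℝ g).smulRight x)
    ((gammaENorm_rankOne_le g x).trans_lt ENNReal.ofReal_lt_top), by
    apply mem_gammaRadonifying_of_finiteRank
    refine Submodule.finiteDimensional_of_le (S₂ := Submodule.span ℝ {x}) ?_
    rintro _ ⟨u, rfl⟩
    exact Submodule.smul_mem _ _ (Submodule.mem_span_singleton_self x)⟩

variable (𝓗 E) in
/-- The bounded bilinear mapping `(g, x) ↦ g ⊗ x` into `γ(𝓗, E)`. -/
noncomputable def gammaRankOne : 𝓗 →L[ℝ] E →L[ℝ] gammaRadonifying 𝓗 E :=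
  LinearMap.mkContinuous₂
    (LinearMap.mk₂ ℝ rankOneAux
      (fun g g' x => Subtype.ext <| GammaSumming.ext_apply fun u => by
        simp [rankOneAux, add_smul])
      (fun c g x => Subtype.ext <| GammaSumming.ext_apply fun u => by
        simp [rankOneAux, mul_smul])
      (fun g x x' => Subtype.ext <| GammaSumming.ext_apply fun u => by
        simp [rankOneAux])
      (fun c g x => Subtype.ext <| GammaSumming.ext_apply fun u => by
        simp [rankOneAux, smul_comm c])) 1
    fun g x => by
      rw [one_mul]
      exact (GammaSumming.norm_le_iff (by positivity)).2 (gammaENorm_rankOne_le g x)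

@[simp] lemma gammaRankOne_apply (g : 𝓗) (x : E) (u : 𝓗) :
    GammaSumming.toCLM 𝓗 E (gammaRankOne 𝓗 E g x) u = ⟪g, u⟫_ℝ • x := rfl

lemma norm_gammaRankOne_le (g : 𝓗) (x : E) : ‖gammaRankOne 𝓗 E g x‖ ≤ ‖g‖ * ‖x‖ :=
  (GammaSumming.norm_le_iff (by positivity)).2 (gammaENorm_rankOne_le g x)

/-- The rank one operators span a dense subspace of `γ(𝓗, E)`. -/
lemma mem_of_gammaRankOne_mem [CompleteSpace 𝓗] (S : Submodule ℝ (gammaRadonifying 𝓗 E))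
    (hS : IsClosed (S : Set (gammaRadonifying 𝓗 E))) (h : ∀ g x, gammaRankOne 𝓗 E g x ∈ S)
    (R : gammaRadonifying 𝓗 E) : R ∈ S := by
  have hcl : IsClosed (S.map (gammaRadonifying 𝓗 E).subtype : Set (GammaSumming 𝓗 E)) := by
    rw [Submodule.map_coe]
    exact isClosed_gammaRadonifying.isClosedEmbedding_subtypeVal.isClosedMap _ hS
  have hle : finiteRankOperators 𝓗 E ≤ S.map (gammaRadonifying 𝓗 E).subtype := by
    intro R hR
    have hfd : FiniteDimensional ℝ (GammaSumming.toCLM 𝓗 E R).range := hR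
    -- The coordinates of `R` in a basis of its range are bounded functionals; the Riesz theorem
    -- turns each into an inner product, which writes `R` as a sum of rank one operators.
    let b := Module.finBasis ℝ (GammaSumming.toCLM 𝓗 E R).range
    let A : 𝓗 →L[ℝ] (GammaSumming.toCLM 𝓗 E R).range :=
      (GammaSumming.toCLM 𝓗 E R).codRestrict _ fun u => ⟨u, rfl⟩
    let L : ∀ i, 𝓗 →L[ℝ] ℝ := fun i => (LinearMap.toContinuousLinearMap (b.coord i)).comp A
    have hsum : R = (∑ i, gammaRankOne 𝓗 E ((InnerProductSpace.toDual ℝ 𝓗).symm (L i)) (b i) :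
        gammaRadonifying 𝓗 E) := by
      refine GammaSumming.ext_apply fun u => ?_
      have h1 := congrArg (Subtype.val) (b.sum_repr (A u))
      rw [Submodule.coe_sum, map_sum, sum_apply]
      simp only [gammaRankOne_apply, InnerProductSpace.toDual_symm_apply]
      rw [Submodule.coe_sum] at h1
      exact h1.symm
    rw [hsum]
    exact ⟨_, S.sum_mem fun i _ => h _ _, rfl⟩
  obtain ⟨R', hR', hRR'⟩ := Submodule.topologicalClosure_minimal _ hle hcl R.2
  rwa [← Subtype.ext hRR']

lemma IsGammaBoundedWith.mono {𝒯 : Set (E →L[ℝ] F)} {C C' : ℝ≥0} (h : IsGammaBoundedWith 𝒯 C)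
    (hC : C ≤ C') : IsGammaBoundedWith 𝒯 C' := fun N x T hT =>
  (h N x T hT).trans (by gcongr)

lemma isGammaBoundedWith_of_gammaBound_lt {𝒯 : Set (E →L[ℝ] F)} {C : ℝ≥0}
    (h : gammaBound 𝒯 < C) : IsGammaBoundedWith 𝒯 C := by
  obtain ⟨C', h⟩ := iInf_lt_iff.1 h
  obtain ⟨hC', h⟩ := iInf_lt_iff.1 h
  exact hC'.mono (by exact_mod_cast h.le)

lemma IsGammaBoundedWith.norm_apply_le {𝒯 : Set (E →L[ℝ] F)} {C : ℝ≥0}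
    (h : IsGammaBoundedWith 𝒯 C) {T : E →L[ℝ] F} (hT : T ∈ 𝒯) (x : E) : ‖T x‖ ≤ C * ‖x‖ := by
  have h1 := h 1 (fun _ => x) (fun _ => T) fun _ => hT
  rw [gaussianNorm_single, gaussianNorm_single, enorm_eq_nnnorm, enorm_eq_nnnorm] at h1
  exact_mod_cast h1

/-- Pointwise limits of uniformly `γ`-bounded functions. -/
lemma IsGammaBoundedWith.image_of_tendsto {X : Type*} {s : Set X} {M : ℕ → X → E →L[ℝ] F}
    {M₀ : X → E →L[ℝ] F} {C : ℝ≥0} (h : ∀ n, IsGammaBoundedWith (M n '' s) C)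
    (hM : ∀ t ∈ s, ∀ x, Tendsto (fun n => M n t x) atTop (𝓝 (M₀ t x))) :
    IsGammaBoundedWith (M₀ '' s) C := by
  intro N x T hT
  choose t ht hTt using hT
  refine gaussianNorm_le_of_tendsto (x := fun n j => M n (t j) (x j)) (fun j => ?_)
    (Eventually.of_forall fun n => h n N x (fun j => M n (t j)) fun j => ⟨t j, ht j, rfl⟩)
  rw [← hTt]
  exact hM _ (ht j) _

/-- Operators assembled from a finite orthogonal decomposition of the identity and
a `γ`-bounded family. -/
lemma gammaENorm_sum_comp_le {ι : Type*} [Fintype ι] {P : ι → 𝓗 →L[ℝ] 𝓗}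
    (hsymm : ∀ i u v, ⟪P i u, v⟫_ℝ = ⟪u, P i v⟫_ℝ) (hidem : ∀ i u, P i (P i u) = P i u)
    (hdisj : ∀ i j, i ≠ j → ∀ u, P i (P j u) = 0) (hsum : ∀ u, ∑ i, P i u = u)
    {𝒯 : Set (E →L[ℝ] F)} {C : ℝ≥0} (h𝒯 : IsGammaBoundedWith 𝒯 C)
    {T : ι → E →L[ℝ] F} (hT : ∀ i, T i ∈ 𝒯) (R : 𝓗 →L[ℝ] E) :
    gammaENorm (∑ i, (T i).comp (R.comp (P i))) ≤ C * gammaENorm R := by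
  classical
  refine iSup_le fun k => iSup_le fun g => iSup_le fun hg => ?_
  -- The spaces `V i` are mutually orthogonal, so their orthonormal bases combine into one
  -- orthonormal system. Its span contains every `g j = ∑ i, P i (g j)`, and each member is fixed by
  -- one `P i` and killed by the others.
  let V : ι → Submodule ℝ 𝓗 := fun i => Submodule.span ℝ (range fun j => P i (g j))
  have hfd : ∀ i, FiniteDimensional ℝ (V i) := fun i =>
    FiniteDimensional.span_of_finite ℝ (finite_range _)
  have hPV : ∀ i, ∀ v ∈ V i, P i v = v := fun i v hv => by
    have : V i ≤ LinearMap.eqLocus (P i : 𝓗 →ₗ[ℝ] 𝓗) LinearMap.id := by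
      refine Submodule.span_le.2 ?_
      rintro _ ⟨j, rfl⟩
      exact hidem i (g j)
    exact this hv
  have hPV' : ∀ i j, i ≠ j → ∀ v ∈ V j, P i v = 0 := fun i j hij v hv => by
    rw [← hPV j v hv, hdisj i j hij]
  have hV : OrthogonalFamily ℝ (fun i => V i) fun i => (V i).subtypeₗᵢ := by
    refine OrthogonalFamily.of_pairwise fun i j hij => ?_
    rw [Function.onFun, Submodule.isOrtho_iff_inner_eq]
    intro u hu v hv
    rw [← hPV i u hu, hsymm, hPV' i j hij v hv, inner_zero_right]
  have he := hV.orthonormal_sigma_orthonormal (v_family := fun i => stdOrthonormalBasis ℝ (V i))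
    fun i => (stdOrthonormalBasis ℝ (V i)).orthonormal
  set e : (Σ i, Fin (Module.finrank ℝ (V i))) → 𝓗 :=
    fun a => (V a.1).subtypeₗᵢ (stdOrthonormalBasis ℝ (V a.1) a.2) with he_def
  let σ := (Fintype.equivFin (Σ i, Fin (Module.finrank ℝ (V i)))).symm
  have hσ : Orthonormal ℝ (e ∘ σ) := he.comp σ σ.injective
  have heV : ∀ a, e a ∈ V a.1 := fun a => (stdOrthonormalBasis ℝ (V a.1) a.2).2
  have hspan : ∀ j, g j ∈ Submodule.span ℝ (range (e ∘ σ)) := by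
    intro j
    rw [σ.surjective.range_comp, ← hsum (g j)]
    refine Submodule.sum_mem _ fun i _ => ?_
    have h1 : P i (g j) ∈ V i := Submodule.subset_span ⟨j, rfl⟩
    have h2 := congrArg Subtype.val ((stdOrthonormalBasis ℝ (V i)).sum_repr ⟨_, h1⟩)
    rw [Submodule.coe_sum] at h2
    rw [← show _ = P i (g j) from h2]
    refine Submodule.sum_mem _ fun l _ => Submodule.smul_mem _ _ (Submodule.subset_span ?_)
    exact ⟨⟨i, l⟩, rfl⟩
  refine (gaussianNorm_le_of_mem_span hg hσ hspan _).trans ?_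
  have h3 : ∀ l, (∑ i, (T i).comp (R.comp (P i))) ((e ∘ σ) l) = T (σ l).1 (R (e (σ l))) := by
    intro l
    rw [sum_apply, Finset.sum_eq_single (σ l).1]
    · simp [hPV _ _ (heV (σ l))]
    · intro i _ hi
      simp [hPV' i _ hi _ (heV (σ l))]
    · simp
  simp_rw [h3]
  refine (h𝒯 _ (fun l => R (e (σ l))) (fun l => T (σ l).1) fun l => hT _).trans ?_
  gcongr
  exact gaussianNorm_le_gammaENorm R hσ

end GammaSpace

/-- The common bound makes the family equicontinuous. -/
lemma isClosed_setOf_tendsto_zero {ι X Y : Type*} [NormedAddCommGroup X] [NormedSpace ℝ X]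
    [NormedAddCommGroup Y] [NormedSpace ℝ Y] {l : Filter ι} {B : ι → X →L[ℝ] Y} {K : ℝ≥0}
    (h : ∀ i x, ‖B i x‖ ≤ K * ‖x‖) : IsClosed {x | Tendsto (fun i => B i x) l (𝓝 0)} := by
  have hlip : ∀ i, LipschitzWith K (B i) := fun i =>
    AddMonoidHomClass.lipschitz_of_bound_nnnorm (B i) K (h i)
  have he := (LipschitzWith.uniformEquicontinuous (fun i => ⇑(B i)) K hlip).equicontinuous
  exact he.isClosed_setOfPred_tendsto (f := fun _ => (0 : Y)) continuous_const

/-- Strong convergence to zero of a bounded family of operators on `γ(𝓗, E)` has to be checked on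
rank one operators only. -/
lemma tendsto_zero_of_gammaRankOne {ι 𝓗 E Y : Type*} [NormedAddCommGroup 𝓗]
    [InnerProductSpace ℝ 𝓗] [CompleteSpace 𝓗] [NormedAddCommGroup E] [NormedSpace ℝ E]
    [NormedAddCommGroup Y] [NormedSpace ℝ Y]
    {l : Filter ι} {B : ι → gammaRadonifying 𝓗 E →L[ℝ] Y} {K : ℝ≥0}
    (h : ∀ i R, ‖B i R‖ ≤ K * ‖R‖)
    (h1 : ∀ g x, Tendsto (fun i => B i (gammaRankOne 𝓗 E g x)) l (𝓝 0))
    (R : gammaRadonifying 𝓗 E) : Tendsto (fun i => B i R) l (𝓝 0) :=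
  mem_of_gammaRankOne_mem
    { carrier := {R | Tendsto (fun i => B i R) l (𝓝 0)}
      zero_mem' := by simpa using tendsto_const_nhds
      add_mem' := fun {R S} hR hS => by simpa using Tendsto.add hR hS
      smul_mem' := fun c R hR => by simpa using Tendsto.const_smul hR c }
    (isClosed_setOf_tendsto_zero h) h1 R

/-! ### Indicator multiplications on `L²`. -/

section LpIndicator

variable {α H : Type*} [MeasurableSpace α] {μ : Measure α} [NormedAddCommGroup H]
  [InnerProductSpace ℝ H]

/-- Multiplication by the indicator function of a measurable set, on `L²(μ; H)`. -/
noncomputable def lpIndicator (μ : Measure α) (H : Type*) [NormedAddCommGroup H]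
    [InnerProductSpace ℝ H] {A : Set α} (hA : MeasurableSet A) : Lp H 2 μ →L[ℝ] Lp H 2 μ :=
  LinearMap.mkContinuous
    { toFun := fun f => ((Lp.memLp f).indicator hA).toLp _
      map_add' := fun f g => by
        rw [← MemLp.toLp_add, MemLp.toLp_eq_toLp_iff]
        filter_upwards [Lp.coeFn_add f g] with t ht
        by_cases h : t ∈ A
        · simpa [h] using ht
        · simp [h]
      map_smul' := fun c f => by
        rw [RingHom.id_apply, ← MemLp.toLp_const_smul, MemLp.toLp_eq_toLp_iff]
        filter_upwards [Lp.coeFn_smul c f] with t ht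
        by_cases h : t ∈ A
        · simpa [h] using ht
        · simp [h] } 1
    fun f => by
      rw [one_mul]
      refine Lp.norm_le_norm_of_ae_le ?_
      filter_upwards [((Lp.memLp f).indicator hA).coeFn_toLp] with t ht
      simp only [LinearMap.coe_mk, AddHom.coe_mk, ht]
      exact norm_indicator_le_norm_self _ _

lemma lpIndicator_coeFn {A : Set α} (hA : MeasurableSet A) (f : Lp H 2 μ) :
    lpIndicator μ H hA f =ᵐ[μ] A.indicator f :=
  ((Lp.memLp f).indicator hA).coeFn_toLp

lemma norm_lpIndicator_le {A : Set α} (hA : MeasurableSet A) (f : Lp H 2 μ) :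
    ‖lpIndicator μ H hA f‖ ≤ ‖f‖ := by
  refine Lp.norm_le_norm_of_ae_le ?_
  filter_upwards [lpIndicator_coeFn hA f] with t ht
  rw [ht]
  exact norm_indicator_le_norm_self _ _

lemma inner_lpIndicator_left {A : Set α} (hA : MeasurableSet A) (f g : Lp H 2 μ) :
    ⟪lpIndicator μ H hA f, g⟫_ℝ = ∫ t, A.indicator (fun t => ⟪f t, g t⟫_ℝ) t ∂μ := by
  rw [L2.inner_def]
  refine integral_congr_ae ?_
  filter_upwards [lpIndicator_coeFn hA f] with t ht
  by_cases h : t ∈ A <;> simp [h, ht]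

lemma inner_lpIndicator_right {A : Set α} (hA : MeasurableSet A) (f g : Lp H 2 μ) :
    ⟪f, lpIndicator μ H hA g⟫_ℝ = ∫ t, A.indicator (fun t => ⟪f t, g t⟫_ℝ) t ∂μ := by
  rw [real_inner_comm, inner_lpIndicator_left]
  simp_rw [real_inner_comm]

end LpIndicator

/-! ### The multiplier theorem for step functions. -/

section StepMultiplier

variable {H E F : Type*} [NormedAddCommGroup H] [InnerProductSpace ℝ H]
  [NormedAddCommGroup E] [NormedSpace ℝ E] [NormedAddCommGroup F] [NormedSpace ℝ F]
  {μ : Measure ℝ}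

/-- The multiplication operator with symbol `t ↦ N (p t)`, for a simple function `p`. -/
noncomputable def stepMul (N : ℝ → E →L[ℝ] F) (p : SimpleFunc ℝ ℝ) (R : Lp H 2 μ →L[ℝ] E) :
    Lp H 2 μ →L[ℝ] F :=
  ∑ v : p.range, (N v).comp (R.comp (lpIndicator μ H (p.measurableSet_fiber v)))

open scoped Classical in
-- Multiplications by the indicators of the fibres of `p` form a finite orthogonal decomposition of
-- the identity.
lemma gammaENorm_stepMul_le {N : ℝ → E →L[ℝ] F} {p : SimpleFunc ℝ ℝ} {s : Set ℝ} {C : ℝ≥0}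
    (hN : IsGammaBoundedWith (N '' s) C) (hp : ∀ t, p t ∈ s) (R : Lp H 2 μ →L[ℝ] E) :
    gammaENorm (stepMul N p R) ≤ C * gammaENorm R := by
  refine gammaENorm_sum_comp_le (T := fun v : p.range => N v) (fun v f g => ?_) (fun v f => ?_)
    (fun v w hvw f => ?_) (fun f => ?_) hN (fun v => ?_) R
  · rw [inner_lpIndicator_left, inner_lpIndicator_right]
  · refine Lp.ext ?_
    filter_upwards [lpIndicator_coeFn (p.measurableSet_fiber v) f, lpIndicator_coeFn
      (p.measurableSet_fiber v) (lpIndicator μ H (p.measurableSet_fiber v) f)] with t h1 h2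
    rw [h2, indicator_apply, h1]
    simp +contextual [indicator_apply]
  · refine Lp.ext ?_
    filter_upwards [lpIndicator_coeFn (p.measurableSet_fiber w) f, lpIndicator_coeFn
      (p.measurableSet_fiber v) (lpIndicator μ H (p.measurableSet_fiber w) f),
      Lp.coeFn_zero H 2 μ] with t h1 h2 h3
    rw [h2, h3, indicator_apply, h1]
    by_cases hv : p t = v
    · have : p t ≠ w := fun hw => hvw (Subtype.ext (hv.symm.trans hw))
      simp [this]
    · simp [hv]
  · refine Lp.ext ?_
    have h1 : ∀ᵐ t ∂μ, ∀ v : p.range, lpIndicator μ H (p.measurableSet_fiber v) f t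
        = (p ⁻¹' {v.1}).indicator f t :=
      ae_all_iff.2 fun v => lpIndicator_coeFn (p.measurableSet_fiber v) f
    filter_upwards [h1, Lp.coeFn_finsetSum Finset.univ fun v : p.range =>
      lpIndicator μ H (p.measurableSet_fiber v) f] with t h1 h2
    rw [h2, Finset.sum_apply]
    simp_rw [h1]
    rw [Finset.sum_eq_single ⟨p t, p.mem_range_self t⟩]
    · simp
    · intro v _ hv
      rw [indicator_of_notMem]
      exact fun h => hv (Subtype.ext (show p t = v.1 from h).symm)
    · simp
  · obtain ⟨t, ht⟩ := p.mem_range.1 v.2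
    exact ⟨v, ht ▸ hp t, rfl⟩

lemma stepMul_rankOne [CompleteSpace F] (N : ℝ → E →L[ℝ] F) (p : SimpleFunc ℝ ℝ) (g : Lp H 2 μ) (x : E)
    (u : Lp H 2 μ) :
    stepMul N p (GammaSumming.toCLM (Lp H 2 μ) E (gammaRankOne (Lp H 2 μ) E g x)) u
      = ∫ t, ⟪g t, u t⟫_ℝ • N (p t) x ∂μ := by
  have h1 : ∀ t, ⟪g t, u t⟫_ℝ • N (p t) x
      = ∑ v : p.range, (p ⁻¹' {v.1}).indicator (fun t => ⟪g t, u t⟫_ℝ) t • N v x := fun t => by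
    rw [Finset.sum_eq_single ⟨p t, p.mem_range_self t⟩]
    · simp
    · intro v _ hv
      rw [indicator_of_notMem, zero_smul]
      exact fun h => hv (Subtype.ext (show p t = v.1 from h).symm)
    · simp
  simp_rw [h1]
  rw [integral_finsetSum]
  · simp only [stepMul, sum_apply, ContinuousLinearMap.comp_apply, gammaRankOne_apply, map_smul]
    refine Finset.sum_congr rfl fun v _ => ?_
    rw [inner_lpIndicator_right, integral_smul_const]
  · intro v _
    exact ((L2.integrable_inner g u).indicator (p.measurableSet_fiber v)).smul_const _

end StepMultiplier

/-! ### The multiplication operator for a strongly continuous symbol. -/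

section Multiplication

variable {H E F : Type*} [NormedAddCommGroup H] [InnerProductSpace ℝ H]
  [NormedAddCommGroup E] [NormedSpace ℝ E] [NormedAddCommGroup F] [NormedSpace ℝ F]

/-- `T` is the multiplication operator with symbol `N` on rank one operators. -/
def MultipliesRankOne (a b : ℝ) (N : ℝ → E →L[ℝ] F)
    (T : gammaRadonifying (L2Interval a b H) E →L[ℝ] GammaSumming (L2Interval a b H) F) : Prop :=
  ∀ (g : L2Interval a b H) (x : E) (u : L2Interval a b H),
    GammaSumming.toCLM _ _ (T (gammaRankOne _ _ g x)) u
      = ∫ t in Ioo a b, ⟪g t, u t⟫_ℝ • N t x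

lemma exists_multipliesRankOne [CompleteSpace H] [CompleteSpace F] {a b : ℝ} (hab : a < b) {N : ℝ → E →L[ℝ] F}
    {C : ℝ≥0} (hN : IsGammaBoundedWith (N '' Ioo a b) C)
    (hcont : ∀ x, ContinuousOn (fun t => N t x) (Ioo a b)) :
    ∃ T : gammaRadonifying (L2Interval a b H) E →L[ℝ] GammaSumming (L2Interval a b H) F,
      (∀ R, ‖T R‖ ≤ C * ‖R‖) ∧ MultipliesRankOne a b N T := by
  set μ := volume.restrict (Ioo a b) with hμ
  have hmid : (a + b) / 2 ∈ Ioo a b := ⟨by linarith, by linarith⟩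
  -- All values of `p n` must lie in `(a, b)`, where the `γ`-bound holds; the midpoint is the base
  -- value required by `approxOn`.
  let p : ℕ → SimpleFunc ℝ ℝ :=
    SimpleFunc.approxOn id measurable_id (Ioo a b) ((a + b) / 2) hmid
  have hp : ∀ n t, p n t ∈ Ioo a b := fun n t => SimpleFunc.approxOn_mem _ _ n t
  have hpt : ∀ t ∈ Ioo a b, Tendsto (fun n => p n t) atTop (𝓝 t) := fun t ht =>
    SimpleFunc.tendsto_approxOn _ _ (subset_closure ht)
  let ρ : gammaRadonifying (Lp H 2 μ) E →ₗ[ℝ] (Lp H 2 μ →L[ℝ] E) :=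
    (GammaSumming.toCLM _ _).comp (gammaRadonifying (Lp H 2 μ) E).subtype
  have hbound : ∀ n R, gammaENorm (stepMul N (p n) (ρ R)) ≤ ENNReal.ofReal (C * ‖R‖) :=
    fun n R => by
      refine (gammaENorm_stepMul_le hN (hp n) _).trans (le_of_eq ?_)
      rw [ENNReal.ofReal_mul (NNReal.coe_nonneg C)]
      congr 1
      · simp
      · exact (GammaSumming.ofReal_norm_eq_gammaENorm R.1).symm
  let A : ℕ → gammaRadonifying (Lp H 2 μ) E →L[ℝ] GammaSumming (Lp H 2 μ) F := fun n =>
    LinearMap.mkContinuous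
      { toFun := fun R => GammaSumming.mk (stepMul N (p n) (ρ R))
          ((hbound n R).trans_lt ENNReal.ofReal_lt_top)
        map_add' := fun R S => GammaSumming.ext_apply fun u => by
          simp [stepMul, Finset.sum_add_distrib]
        map_smul' := fun c R => GammaSumming.ext_apply fun u => by
          simp [stepMul, Finset.smul_sum] } C
      fun R => (GammaSumming.norm_le_iff (by positivity)).2 (hbound n R)
  have hAn : ∀ n R, ‖A n R‖ ≤ C * ‖R‖ := fun n R =>
    (GammaSumming.norm_le_iff (by positivity)).2 (hbound n R)
  have hrank : ∀ g x u, Tendsto (fun n => GammaSumming.toCLM _ _ (A n (gammaRankOne _ _ g x)) u)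
      atTop (𝓝 (∫ t, ⟪g t, u t⟫_ℝ • N t x ∂μ)) := by
    intro g x u
    have h1 : ∀ n, GammaSumming.toCLM _ _ (A n (gammaRankOne _ _ g x)) u
        = ∫ t, ⟪g t, u t⟫_ℝ • N (p n t) x ∂μ := fun n => stepMul_rankOne N (p n) g x u
    simp_rw [h1]
    refine tendsto_integral_of_dominated_convergence (fun t => ‖⟪g t, u t⟫_ℝ‖ * (C * ‖x‖))
      (fun n => ?_) ((L2.integrable_inner g u).norm.mul_const _) (fun n => ?_) ?_
    · refine (L2.integrable_inner g u).aestronglyMeasurable.smul ?_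
      exact ((p n).map fun t => N t x).aestronglyMeasurable
    · refine Eventually.of_forall fun t => ?_
      rw [norm_smul]
      gcongr
      exact hN.norm_apply_le ⟨_, hp n t, rfl⟩ x
    · filter_upwards [ae_restrict_mem measurableSet_Ioo] with t ht
      refine Tendsto.const_smul ?_ _
      exact ((hcont x).continuousAt (isOpen_Ioo.mem_nhds ht)).tendsto.comp (hpt t ht)
  have hcauchy : ∀ R u, CauchySeq fun n => GammaSumming.toCLM _ _ (A n R) u := by
    intro R u
    -- The Cauchy property is convergence to zero of the differences indexed by pairs, a bounded
    -- family, so rank one operators suffice.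
    have h2 := tendsto_zero_of_gammaRankOne (l := atTop) (K := 2 * C * ‖u‖₊)
      (B := fun q : ℕ × ℕ => (GammaSumming.eval F u).comp (A q.1 - A q.2)) (fun q R => ?_)
      (fun g x => ?_) R
    · rw [cauchySeq_iff_tendsto_dist_atTop_0]
      simpa [dist_eq_norm] using h2.norm
    · have h3 := GammaSumming.norm_apply_le (A q.1 R - A q.2 R) u
      have h4 := (norm_sub_le (A q.1 R) (A q.2 R)).trans (add_le_add (hAn _ _) (hAn _ _))
      simp only [ContinuousLinearMap.comp_apply, sub_apply, GammaSumming.eval_apply]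
      refine h3.trans ?_
      push_cast
      calc _ ≤ (C * ‖R‖ + C * ‖R‖) * ‖u‖ := by gcongr
        _ = _ := by ring
    · have h5 := (hrank g x u).cauchySeq
      rw [cauchySeq_iff_tendsto_dist_atTop_0] at h5
      rw [tendsto_zero_iff_norm_tendsto_zero]
      simpa [dist_eq_norm] using h5
  choose L hL using fun R u => cauchySeq_tendsto_of_complete (hcauchy R u)
  let Λ : gammaRadonifying (Lp H 2 μ) E → Lp H 2 μ →L[ℝ] F := fun R =>
    continuousLinearMapOfTendsto (fun n => GammaSumming.toCLM _ _ (A n R)) (f := L R)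
      (tendsto_pi_nhds.2 (hL R))
  have hΛ : ∀ R, gammaENorm (Λ R) ≤ ENNReal.ofReal (C * ‖R‖) := fun R =>
    gammaENorm_le_of_tendsto (hL R) (Eventually.of_forall fun n => hbound n R)
  let T : gammaRadonifying (Lp H 2 μ) E →L[ℝ] GammaSumming (Lp H 2 μ) F :=
    LinearMap.mkContinuous
      { toFun := fun R => GammaSumming.mk (Λ R) ((hΛ R).trans_lt ENNReal.ofReal_lt_top)
        map_add' := fun R S => GammaSumming.ext_apply fun u => by
          refine tendsto_nhds_unique (hL (R + S) u) ?_
          simp only [map_add, add_apply]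
          exact (hL R u).add (hL S u)
        map_smul' := fun c R => GammaSumming.ext_apply fun u => by
          refine tendsto_nhds_unique (hL (c • R) u) ?_
          simp only [map_smul, smul_apply]
          exact (hL R u).const_smul c } C
      fun R => (GammaSumming.norm_le_iff (by positivity)).2 (hΛ R)
  exact ⟨T, fun R => (GammaSumming.norm_le_iff (by positivity)).2 (hΛ R), fun g x u =>
    tendsto_nhds_unique (hL _ u) (hrank g x u)⟩

end Multiplication

lemma integrable_inner_smul {H F : Type*} [NormedAddCommGroup H] [InnerProductSpace ℝ H]
    [NormedAddCommGroup F] [NormedSpace ℝ F]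
    {α : Type*} [MeasurableSpace α] {μ : Measure α} (g u : Lp H 2 μ)
    {m : α → F} (hm : AEStronglyMeasurable m μ) {K : ℝ} (hK : ∀ᵐ t ∂μ, ‖m t‖ ≤ K) :
    Integrable (fun t => ⟪g t, u t⟫_ℝ • m t) μ := by
  refine ((L2.integrable_inner (𝕜 := ℝ) g u).norm.mul_const K).mono'
    ((L2.integrable_inner (𝕜 := ℝ) g u).aestronglyMeasurable.smul hm) ?_
  filter_upwards [hK] with t ht
  rw [norm_smul]
  gcongr

/-! ### From rank one operators to elementary functions, and uniqueness. -/

section Representation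

variable {H E F : Type*} [NormedAddCommGroup H] [InnerProductSpace ℝ H] [CompleteSpace H]
  [NormedAddCommGroup E] [NormedSpace ℝ E] [NormedAddCommGroup F] [NormedSpace ℝ F]

lemma adjointVector_comp_elementaryFunction {k : ℕ} (T : E →L[ℝ] F) (f : Fin k → ℝ → ℝ)
    (h : Fin k → H) (x : Fin k → E) (t : ℝ) (φ : F →L[ℝ] ℝ) :
    adjointVector (T.comp (elementaryFunction f h x t)) φ
      = ∑ m, (f m t * φ (T (x m))) • h m := by
  unfold adjointVector
  rw [LinearIsometryEquiv.symm_apply_eq]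
  ext v
  simp [elementaryFunction, sum_apply, mul_comm, mul_left_comm]

lemma represents_unique {X : Type*} [MeasurableSpace X] {μ : Measure X} {Φ : X → H →L[ℝ] E}
    {R S : Lp H 2 μ →L[ℝ] E} (hR : Represents μ Φ R) (hS : Represents μ Φ S) : R = S := by
  ext u
  rw [SeparatingDual.eq_iff_forall_dual_eq (R := ℝ)]
  intro φ
  rw [hR.2 u φ, hS.2 u φ]

/-- Serves twice: with `N` the identity for `R_Φ`, and with the actual symbol for `R_{NΦ}`. -/
lemma represents_mul_elementary [CompleteSpace F] {μ : Measure ℝ} {N : ℝ → E →L[ℝ] F}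
    (hN : ∀ x, AEStronglyMeasurable (fun t => N t x) μ) {K : ℝ}
    (hK : ∀ x, ∀ᵐ t ∂μ, ‖N t x‖ ≤ K * ‖x‖) {k : ℕ} {f : Fin k → ℝ → ℝ} {h : Fin k → H}
    {x : Fin k → E} {g : Fin k → Lp H 2 μ} (hf : ∀ m, MemLp (f m) 2 μ)
    (hg : ∀ m, g m =ᵐ[μ] fun t => f m t • h m) {S : Lp H 2 μ →L[ℝ] F}
    (hS : ∀ u, S u = ∑ m, ∫ t, ⟪g m t, u t⟫_ℝ • N t (x m) ∂μ) :
    Represents μ (fun t => (N t).comp (elementaryFunction f h x t)) S := by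
  refine ⟨fun φ => ?_, fun u φ => ?_⟩
  · simp_rw [adjointVector_comp_elementaryFunction]
    refine memLp_finsetSum _ fun m _ => ?_
    refine (hf m).of_le_mul (c := ‖φ‖ * (K * ‖x m‖) * ‖h m‖) ?_ ?_
    · exact ((hf m).aestronglyMeasurable.mul
        (φ.continuous.comp_aestronglyMeasurable (hN (x m)))).smul_const (h m)
    · filter_upwards [hK (x m)] with t ht
      rw [norm_smul, norm_mul]
      calc ‖f m t‖ * ‖φ (N t (x m))‖ * ‖h m‖ ≤ ‖f m t‖ * (‖φ‖ * (K * ‖x m‖)) * ‖h m‖ := by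
            gcongr
            exact (φ.le_opNorm _).trans (by gcongr)
        _ = _ := by ring
  · have hint : ∀ m, Integrable (fun t => ⟪g m t, u t⟫_ℝ • N t (x m)) μ := fun m =>
      integrable_inner_smul (g m) u (hN (x m)) (hK (x m))
    simp_rw [adjointVector_comp_elementaryFunction]
    rw [hS, map_sum]
    simp_rw [← φ.integral_comp_comm (hint _)]
    rw [← integral_finsetSum _ fun m _ => φ.integrable_comp (hint m)]
    refine integral_congr_ae ?_
    filter_upwards [ae_all_iff.2 hg] with t ht
    simp only [ht, inner_sum, inner_smul_left, inner_smul_right, map_smul, smul_eq_mul,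
      RCLike.conj_to_real]
    refine Finset.sum_congr rfl fun m _ => ?_
    rw [real_inner_comm]
    ring

variable {a b : ℝ}

lemma represents_sum_gammaRankOne [CompleteSpace E] {μ : Measure ℝ} {k : ℕ} {f : Fin k → ℝ → ℝ}
    {h : Fin k → H} {x : Fin k → E} {g : Fin k → Lp H 2 μ} (hf : ∀ m, MemLp (f m) 2 μ)
    (hg : ∀ m, g m =ᵐ[μ] fun t => f m t • h m) :
    Represents μ (elementaryFunction f h x) (GammaSumming.toCLM _ _
      (∑ m, gammaRankOne (Lp H 2 μ) E (g m) (x m) : gammaRadonifying (Lp H 2 μ) E)) := by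
  refine represents_mul_elementary (N := fun _ => ContinuousLinearMap.id ℝ E) (K := 1)
    (fun x => aestronglyMeasurable_const) (fun x => by simp) hf hg fun u => ?_
  rw [Submodule.coe_sum, map_sum, sum_apply]
  refine Finset.sum_congr rfl fun m _ => ?_
  rw [gammaRankOne_apply, L2.inner_def, ← integral_smul_const]
  rfl

lemma MultipliesRankOne.isMultiplicationOperator [CompleteSpace E] [CompleteSpace F]
    {N : ℝ → E →L[ℝ] F} {C : ℝ≥0} (hN : IsGammaBoundedWith (N '' Ioo a b) C)
    (hcont : ∀ x, ContinuousOn (fun t => N t x) (Ioo a b))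
    {T : gammaRadonifying (L2Interval a b H) E →L[ℝ] GammaSumming (L2Interval a b H) F}
    (hT : MultipliesRankOne a b N T) : IsMultiplicationOperator a b N T := by
  intro k f h x hf R hR
  let hg : ∀ m, MemLp (fun t => f m t • h m) 2 (volume.restrict (Ioo a b)) := fun m =>
    (hf m).of_le_mul (c := ‖h m‖) ((hf m).aestronglyMeasurable.smul_const (h m))
      (ae_of_all _ fun t => by rw [norm_smul, mul_comm])
  have hg' : ∀ m, (hg m).toLp _ =ᵐ[volume.restrict (Ioo a b)] fun t => f m t • h m :=
    fun m => (hg m).coeFn_toLp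
  -- The represented operator is determined by its symbol, so `R` has to be this sum.
  have hR' : R = ∑ m, gammaRankOne (L2Interval a b H) E ((hg m).toLp _) (x m) :=
    Subtype.ext (GammaSumming.toCLM_injective
      (represents_unique hR (represents_sum_gammaRankOne hf hg')))
  refine represents_mul_elementary
    (fun x => (hcont x).aestronglyMeasurable measurableSet_Ioo) (K := C) (fun x => ?_) hf hg'
    fun u => ?_
  · filter_upwards [ae_restrict_mem measurableSet_Ioo] with t ht
    exact hN.norm_apply_le ⟨t, ht, rfl⟩ x
  · rw [hR', map_sum, map_sum, sum_apply]
    exact Finset.sum_congr rfl fun m _ => hT _ _ u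

lemma IsMultiplicationOperator.unique [CompleteSpace E] {N : ℝ → E →L[ℝ] F}
    {T T' : gammaRadonifying (L2Interval a b H) E →L[ℝ] GammaSumming (L2Interval a b H) F}
    (hT : IsMultiplicationOperator a b N T) (hT' : IsMultiplicationOperator a b N T') :
    T = T' := by
  have hrank : ∀ (g : L2Interval a b H) (x : E),
      T (gammaRankOne _ _ g x) = T' (gammaRankOne _ _ g x) := by
    intro g x
    -- The hypothesis tests only elementary functions. An indicator times a constant vector of `H`
    -- is a one-term case; linearity and density reach every `g`.
    refine Lp.induction (by norm_num) (motive := fun g : L2Interval a b H =>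
      T (gammaRankOne _ _ g x) = T' (gammaRankOne _ _ g x)) ?_ ?_ ?_ g
    · intro c s hs hμs
      have hf : ∀ _ : Fin 1, MemLp (s.indicator fun _ : ℝ => (1 : ℝ)) 2
          (volume.restrict (Ioo a b)) := fun _ => memLp_indicator_const 2 hs 1 (Or.inr hμs.ne)
      have hR := represents_sum_gammaRankOne (μ := volume.restrict (Ioo a b)) (k := 1)
        (x := fun _ => x) (h := fun _ => c)
        (g := fun _ => indicatorConstLp 2 hs hμs.ne c) hf fun _ => by
          filter_upwards [indicatorConstLp_coeFn (p := 2) (hs := hs) (hμs := hμs.ne) (c := c)]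
            with t ht
          rw [ht]
          by_cases h : t ∈ s <;> simp [h]
      have h1 := represents_unique (hT 1 _ _ _ hf _ hR) (hT' 1 _ _ _ hf _ hR)
      simpa using GammaSumming.toCLM_injective h1
    · intro f g hf hg _ h1 h2
      simp only [map_add, add_apply, h1, h2]
    · exact isClosed_eq (by fun_prop) (by fun_prop)
  ext1 R
  have h := mem_of_gammaRankOne_mem (T - T').ker (T - T').isClosed_ker
    (fun g x => by simp [hrank g x]) R
  simpa [sub_eq_zero] using h

end Representation

/-! ### Continuity of cut-offs and the fundamental theorem of calculus. -/

lemma tendsto_lpIndicator {α H ι : Type*} [MeasurableSpace α] {μ : Measure α}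
    [NormedAddCommGroup H] [InnerProductSpace ℝ H] {l : Filter ι} [l.IsCountablyGenerated]
    {A : ι → Set α} {B : Set α} (hA : ∀ i, MeasurableSet (A i)) (hB : MeasurableSet B)
    (h : ∀ᵐ t ∂μ, ∀ᶠ i in l, t ∈ A i ↔ t ∈ B) (g : Lp H 2 μ) :
    Tendsto (fun i => lpIndicator μ H (hA i) g) l (𝓝 (lpIndicator μ H hB g)) := by
  have hsq : ∀ f : Lp H 2 μ, ‖f‖ ^ 2 = ∫ t, ‖f t‖ ^ 2 ∂μ := fun f => by
    rw [← real_inner_self_eq_norm_sq, L2.inner_def]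
    simp_rw [real_inner_self_eq_norm_sq]
  have hae : ∀ i, ∀ᵐ t ∂μ, (lpIndicator μ H (hA i) g - lpIndicator μ H hB g) t
      = (A i).indicator g t - B.indicator g t := fun i => by
    filter_upwards [lpIndicator_coeFn (hA i) g, lpIndicator_coeFn hB g,
      Lp.coeFn_sub (lpIndicator μ H (hA i) g) (lpIndicator μ H hB g)] with t h1 h2 h3
    rw [h3, Pi.sub_apply, h1, h2]
  have hlim : Tendsto (fun i => ‖lpIndicator μ H (hA i) g - lpIndicator μ H hB g‖ ^ 2) l
      (𝓝 0) := by
    have hsq' : ∀ i, ‖lpIndicator μ H (hA i) g - lpIndicator μ H hB g‖ ^ 2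
        = ∫ t, ‖(A i).indicator g t - B.indicator g t‖ ^ 2 ∂μ := fun i => by
      rw [hsq]
      refine integral_congr_ae ?_
      filter_upwards [hae i] with t ht
      rw [ht]
    simp_rw [hsq']
    rw [show (0 : ℝ) = ∫ _, (0 : ℝ) ∂μ by simp]
    have hgm : AEStronglyMeasurable g μ := Lp.aestronglyMeasurable g
    refine tendsto_integral_filter_of_dominated_convergence (fun t => ‖g t‖ ^ 2)
      (Eventually.of_forall fun i => ?_) (Eventually.of_forall fun i => ae_of_all _ fun t => ?_)
      ((Lp.memLp g).integrable_norm_pow (by norm_num)) ?_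
    · exact ((hgm.indicator (hA i)).sub (hgm.indicator hB)).norm.pow 2
    · by_cases h1 : t ∈ A i <;> by_cases h2 : t ∈ B <;> simp [h1, h2]
    · filter_upwards [h] with t ht
      refine tendsto_const_nhds.congr' ?_
      filter_upwards [ht] with i hi
      by_cases h2 : t ∈ B <;> simp [hi, h2]
  rw [tendsto_iff_norm_sub_tendsto_zero]
  simpa using hlim.sqrt

/-- Only the point `t = s` can obstruct convergence, and it is a null set because `μ` has no atoms.
Multiplication by `1_{[s,∞)}` is thus strongly continuous in `s`. -/
lemma continuous_lpIndicator_Ici {H : Type*} {μ : Measure ℝ} [NullSingletonClass μ]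
    [NormedAddCommGroup H] [InnerProductSpace ℝ H] (g : Lp H 2 μ) :
    Continuous fun s : ℝ => lpIndicator μ H (measurableSet_Ici (a := s)) g := by
  refine continuous_iff_continuousAt.2 fun s => tendsto_lpIndicator _ _ ?_ g
  have h : ∀ᵐ t ∂μ, t ≠ s := by simp [ae_iff]
  filter_upwards [h] with t ht
  rcases lt_or_gt_of_ne ht with h | h
  · filter_upwards [lt_mem_nhds h] with r hr
    simp [h.not_ge, hr.not_ge]
  · filter_upwards [gt_mem_nhds h] with r hr
    simp [h.le, hr.le]

lemma ContDiffOn.setIntegral_deriv_eq_sub {F : Type*} [NormedAddCommGroup F] [NormedSpace ℝ F]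
    [CompleteSpace F] {a b c d t : ℝ} {m : ℝ → F} (hm : ContDiffOn ℝ 1 m (Ioo a b))
    (hc : a < c) (hd : d < b) (ht : t ∈ Icc c d) :
    ∫ s in Icc c d, (Iic t).indicator (deriv m) s = m t - m c := by
  rw [integral_indicator measurableSet_Iic, Measure.restrict_restrict measurableSet_Iic,
    show Iic t ∩ Icc c d = Icc c t by ext s; have := ht.2; simp; grind, integral_Icc_eq_integral_Ioc,
    ← intervalIntegral.integral_of_le ht.1]
  have hsub : uIcc c t ⊆ Ioo a b := by
    rw [uIcc_of_le ht.1]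
    exact Icc_subset_Ioo hc (ht.2.trans_lt hd)
  refine intervalIntegral.integral_deriv_eq_sub (fun s hs => ?_) ?_
  · exact (hm.differentiableOn one_ne_zero).differentiableAt (isOpen_Ioo.mem_nhds (hsub hs))
  · exact ((hm.continuousOn_deriv_of_isOpen isOpen_Ioo le_rfl).mono hsub).intervalIntegrable

/-! ### Membership in `γ` through differentiability. -/

section Smooth

variable {H E F : Type*} [NormedAddCommGroup H] [InnerProductSpace ℝ H]
  [NormedAddCommGroup E] [NormedSpace ℝ E] [NormedAddCommGroup F] [NormedSpace ℝ F]
  {a b : ℝ}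

/-- A continuously differentiable `F`-valued function, multiplied by a square integrable function
supported in a compact subinterval, represents an element of `γ(L²(a,b;H), F)`. -/
lemma exists_gammaRadonifying_of_contDiffOn [CompleteSpace F] {m : ℝ → F}
    (hm : ContDiffOn ℝ 1 m (Ioo a b)) {c d ε : ℝ} (hc : a < c) (hcd : c ≤ d) (hd : d < b)
    (h0 : ‖m c‖ ≤ ε) (h1 : ∀ t ∈ Icc c d, ‖deriv m t‖ ≤ ε) (g : L2Interval a b H) :
    ∃ Q : gammaRadonifying (L2Interval a b H) F,
      (∀ u, GammaSumming.toCLM _ _ Q.1 u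
        = ∫ t in Ioo a b, ⟪lpIndicator _ H (measurableSet_Icc (a := c) (b := d)) g t, u t⟫_ℝ • m t)
      ∧ ‖Q‖ ≤ ‖g‖ * (1 + (d - c)) * ε := by
  set μ := volume.restrict (Ioo a b) with hμ
  set f : Lp H 2 μ := lpIndicator μ H (measurableSet_Icc (a := c) (b := d)) g with hf
  have hfg : ‖f‖ ≤ ‖g‖ := norm_lpIndicator_le _ g
  have hε : 0 ≤ ε := (norm_nonneg _).trans h0
  let J : ℝ → Lp H 2 μ := fun s => lpIndicator μ H (measurableSet_Ici (a := s)) f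
  have hJ : ∀ s, ‖J s‖ ≤ ‖g‖ := fun s => (norm_lpIndicator_le _ f).trans hfg
  have hm' : ContinuousOn (deriv m) (Icc c d) :=
    (hm.continuousOn_deriv_of_isOpen isOpen_Ioo le_rfl).mono (Icc_subset_Ioo hc hd)
  have hint : IntegrableOn (fun s => gammaRankOne (Lp H 2 μ) F (J s) (deriv m s)) (Icc c d) := by
    refine ContinuousOn.integrableOn_Icc ?_
    exact (((gammaRankOne (Lp H 2 μ) F).continuous.comp
      (continuous_lpIndicator_Ici f)).continuousOn).clm_apply hm'
  -- On `[c, d]`, `m t = m c + ∫_c^t m'`. Moving the constraint `s ≤ t` onto `f` yields this Bochner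
  -- integral in `γ`, whose integrand is continuous in `s`.
  refine ⟨gammaRankOne _ F f (m c)
    + ∫ s in Icc c d, gammaRankOne (Lp H 2 μ) F (J s) (deriv m s), fun u => ?_, ?_⟩
  · let ev : gammaRadonifying (Lp H 2 μ) F →L[ℝ] F :=
      (GammaSumming.eval F u).comp (gammaRadonifying (Lp H 2 μ) F).subtypeL
    have happly : ∀ Q : gammaRadonifying (Lp H 2 μ) F,
        GammaSumming.toCLM _ _ Q.1 u = ev Q := fun _ => rfl
    rw [happly, map_add, ← ev.integral_comp_comm hint]
    have hψ : Integrable (fun t => ⟪f t, u t⟫_ℝ) μ := L2.integrable_inner f u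
    have hev : ∀ s, ev (gammaRankOne (Lp H 2 μ) F (J s) (deriv m s))
        = ∫ t, {p : ℝ × ℝ | p.2 ≤ p.1}.indicator (fun p => ⟪f p.1, u p.1⟫_ℝ • deriv m p.2) (t, s)
          ∂μ := fun s => by
      change ⟪J s, u⟫_ℝ • deriv m s = _
      rw [inner_lpIndicator_left, ← integral_smul_const]
      congr 1
      funext t
      by_cases hst : s ≤ t <;> simp [hst]
    have hprod : Integrable
        ({p : ℝ × ℝ | p.2 ≤ p.1}.indicator fun p => ⟪f p.1, u p.1⟫_ℝ • deriv m p.2)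
        (μ.prod (volume.restrict (Icc c d))) :=
      (hψ.smul_prod hm'.integrableOn_Icc).indicator
        (measurableSet_le measurable_snd measurable_fst)
    simp_rw [hev]
    -- Fubini: for fixed `t`, the inner integral in `s` becomes the increment `m t - m c`.
    rw [← integral_integral_swap (f := fun t s =>
      {p : ℝ × ℝ | p.2 ≤ p.1}.indicator (fun p => ⟪f p.1, u p.1⟫_ℝ • deriv m p.2) (t, s)) hprod]
    have hev0 : ev (gammaRankOne (Lp H 2 μ) F f (m c)) = ∫ t, ⟪f t, u t⟫_ℝ • m c ∂μ := by
      change ⟪f, u⟫_ℝ • m c = _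
      rw [integral_smul_const, L2.inner_def]
    rw [hev0, ← integral_add (hψ.smul_const _) hprod.integral_prod_left]
    refine integral_congr_ae ?_
    filter_upwards [lpIndicator_coeFn (measurableSet_Icc (a := c) (b := d)) g] with t ht
    by_cases htI : t ∈ Icc c d
    · have h2 : ∀ s, {p : ℝ × ℝ | p.2 ≤ p.1}.indicator
          (fun p => ⟪f p.1, u p.1⟫_ℝ • deriv m p.2) (t, s)
          = ⟪f t, u t⟫_ℝ • (Iic t).indicator (deriv m) s := fun s => by
        by_cases hst : s ≤ t <;> simp [hst]
      simp_rw [h2]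
      rw [integral_smul, hm.setIntegral_deriv_eq_sub hc hd htI, ← smul_add]
      simp
    · have h3 : f t = 0 := by rw [hf, ht, indicator_of_notMem htI]
      simp [h3, indicator]
  · calc _ ≤ ‖f‖ * ‖m c‖ + ‖g‖ * ε * volume.real (Icc c d) := by
          refine (norm_add_le _ _).trans (add_le_add (norm_gammaRankOne_le _ _) ?_)
          refine norm_setIntegral_le_of_norm_le_const (by simp) fun s hs => ?_
          refine (norm_gammaRankOne_le _ _).trans ?_
          gcongr
          exacts [hJ s, h1 s hs]
      _ ≤ ‖g‖ * ε + ‖g‖ * ε * (d - c) := by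
          rw [Real.volume_real_Icc_of_le hcd]
          gcongr
      _ = _ := by ring

lemma MultipliesRankOne.sub {N N' : ℝ → E →L[ℝ] F} {C C' : ℝ≥0}
    (hN : IsGammaBoundedWith (N '' Ioo a b) C)
    (hcont : ∀ x, ContinuousOn (fun t => N t x) (Ioo a b))
    (hN' : IsGammaBoundedWith (N' '' Ioo a b) C')
    (hcont' : ∀ x, ContinuousOn (fun t => N' t x) (Ioo a b))
    {T T' : gammaRadonifying (L2Interval a b H) E →L[ℝ] GammaSumming (L2Interval a b H) F}
    (hT : MultipliesRankOne a b N T) (hT' : MultipliesRankOne a b N' T') :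
    MultipliesRankOne a b (fun t => N t - N' t) (T - T') := by
  intro g x u
  rw [sub_apply, map_sub, sub_apply, hT, hT', ← integral_sub]
  · simp [smul_sub]
  · refine integrable_inner_smul g u ((hcont x).aestronglyMeasurable measurableSet_Ioo)
      (K := C * ‖x‖) ?_
    filter_upwards [ae_restrict_mem measurableSet_Ioo] with t ht
    exact hN.norm_apply_le ⟨t, ht, rfl⟩ x
  · refine integrable_inner_smul g u ((hcont' x).aestronglyMeasurable measurableSet_Ioo)
      (K := C' * ‖x‖) ?_
    filter_upwards [ae_restrict_mem measurableSet_Ioo] with t ht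
    exact hN'.norm_apply_le ⟨t, ht, rfl⟩ x

/-- Functions vanishing near the endpoints are dense in `L²(a,b;H)`. -/
lemma L2Interval.mem_of_compactSupport_mem (hab : a < b) {S : Set (L2Interval a b H)}
    (hS : IsClosed S) (g : L2Interval a b H)
    (h : ∀ c d, a < c → c ≤ d → d < b →
      lpIndicator _ H (measurableSet_Icc (a := c) (b := d)) g ∈ S) : g ∈ S := by
  -- The factor `(b - a) / 2` keeps the left cut-off point at or below the right one; they coincide
  -- for `n = 0`.
  let δ : ℕ → ℝ := fun n => (b - a) / 2 * (1 / ((n : ℝ) + 1))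
  have hδ0 : Tendsto δ atTop (𝓝 0) := by
    simpa only [mul_zero] using
      (tendsto_one_div_add_atTop_nhds_zero_nat (𝕜 := ℝ)).const_mul ((b - a) / 2)
  have hpos : ∀ n, 0 < δ n := fun n =>
    mul_pos (by linarith) (by positivity)
  have hle : ∀ n, δ n ≤ (b - a) / 2 := fun n => by
    refine mul_le_of_le_one_right (by linarith) ?_
    rw [div_le_one (by positivity)]
    linarith [(Nat.cast_nonneg n : (0 : ℝ) ≤ n)]
  have hlim := tendsto_lpIndicator (μ := volume.restrict (Ioo a b)) (l := atTop)
    (A := fun n => Icc (a + δ n) (b - δ n)) (B := univ) (fun _ => measurableSet_Icc)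
    MeasurableSet.univ ?_ g
  · have huniv : lpIndicator (volume.restrict (Ioo a b)) H MeasurableSet.univ g = g := by
      refine Lp.ext ?_
      filter_upwards [lpIndicator_coeFn MeasurableSet.univ g] with t ht
      simp [ht]
    rw [huniv] at hlim
    refine hS.mem_of_tendsto hlim (Eventually.of_forall fun n => ?_)
    exact h _ _ (by linarith [hpos n]) (by linarith [hle n]) (by linarith [hpos n])
  · filter_upwards [ae_restrict_mem measurableSet_Ioo] with t ht
    filter_upwards [hδ0.eventually (gt_mem_nhds (sub_pos.2 ht.1)),
      hδ0.eventually (gt_mem_nhds (sub_pos.2 ht.2))] with n h1 h2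
    simp only [mem_univ, iff_true]
    exact ⟨by linarith, by linarith⟩

/-- Since `γ` is closed and `T` is continuous, it suffices to test rank one operators whose `L²`
factor is supported in some `[c, d]`; there the integral formula applies. -/
lemma MultipliesRankOne.mem_gammaRadonifying [CompleteSpace H] [CompleteSpace F] (hab : a < b)
    {N : ℝ → E →L[ℝ] F} (hN : ∀ x, ContDiffOn ℝ 1 (fun t => N t x) (Ioo a b))
    {T : gammaRadonifying (L2Interval a b H) E →L[ℝ] GammaSumming (L2Interval a b H) F}
    (hT : MultipliesRankOne a b N T) (R : gammaRadonifying (L2Interval a b H) E) :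
    T R ∈ gammaRadonifying (L2Interval a b H) F := by
  refine mem_of_gammaRankOne_mem ((gammaRadonifying (L2Interval a b H) F).comap T.toLinearMap)
    (isClosed_gammaRadonifying.preimage T.continuous) (fun g x => ?_) R
  refine L2Interval.mem_of_compactSupport_mem hab
    (S := {g | T (gammaRankOne _ _ g x) ∈ gammaRadonifying (L2Interval a b H) F})
    (isClosed_gammaRadonifying.preimage (by fun_prop)) g fun c d hc hcd hd => ?_
  obtain ⟨K, hK⟩ := isCompact_Icc.exists_bound_of_continuousOn
    (((hN x).continuousOn_deriv_of_isOpen isOpen_Ioo le_rfl).mono (Icc_subset_Ioo hc hd))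
  obtain ⟨Q, hQ, -⟩ := exists_gammaRadonifying_of_contDiffOn (hN x) hc hcd hd
    (le_max_left ‖N c x‖ K) (fun t ht => (hK t ht).trans (le_max_right _ _)) g
  have h : T (gammaRankOne _ _ (lpIndicator _ H (measurableSet_Icc (a := c) (b := d)) g) x)
      = Q.1 := GammaSumming.ext_apply fun u => by rw [hT, hQ]
  rw [mem_ofPred_eq, h]
  exact Q.2

end Smooth

/-! ### The convergence theorem. -/

theorem lemmal {H E F : Type*}
    [NormedAddCommGroup H] [InnerProductSpace ℝ H] [CompleteSpace H]
    [NormedAddCommGroup E] [NormedSpace ℝ E] [CompleteSpace E]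
    [NormedAddCommGroup F] [NormedSpace ℝ F] [CompleteSpace F]
    (a b : ℝ) (hab : a < b)
    (M : ℕ → ℝ → E →L[ℝ] F) (M₀ : ℝ → E →L[ℝ] F)
    -- (1) strong continuous differentiability on `(a, b)`
    (hM : ∀ n x, ContDiffOn ℝ 1 (fun t => M n t x) (Ioo a b))
    (hM₀ : ∀ x, ContDiffOn ℝ 1 (fun t => M₀ t x) (Ioo a b))
    -- (2) strong convergence of `M n` and of its derivative, uniformly on compact subsets
    (hconv : ∀ x, ∀ K ⊆ Ioo a b, IsCompact K →
      TendstoUniformlyOn (fun n t => M n t x) (fun t => M₀ t x) atTop K)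
    (hconv' : ∀ x, ∀ K ⊆ Ioo a b, IsCompact K →
      TendstoUniformlyOn (fun n t => deriv (fun s => M n s x) t)
        (fun t => deriv (fun s => M₀ s x) t) atTop K)
    -- (3) uniform `γ`-boundedness of the ranges
    (hγ : ∀ n, IsGammaBounded (M n '' Ioo a b))
    (hγ_sup : ⨆ n, gammaBound (M n '' Ioo a b) < ∞) :
    -- the multiplication operators exist and are unique
    (∀ n, ∃! T : gammaRadonifying (L2Interval a b H) E →L[ℝ] GammaSumming (L2Interval a b H) F,
      IsMultiplicationOperator a b (M n) T) ∧
    (∃! T : gammaRadonifying (L2Interval a b H) E →L[ℝ] GammaSumming (L2Interval a b H) F,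
      IsMultiplicationOperator a b M₀ T) ∧
    -- they take values in `γ(L²(a,b;H), F)` and converge strongly there
    ∀ (T : ℕ → gammaRadonifying (L2Interval a b H) E →L[ℝ] GammaSumming (L2Interval a b H) F)
      (T₀ : gammaRadonifying (L2Interval a b H) E →L[ℝ] GammaSumming (L2Interval a b H) F),
      (∀ n, IsMultiplicationOperator a b (M n) (T n)) → IsMultiplicationOperator a b M₀ T₀ →
      ∀ R : gammaRadonifying (L2Interval a b H) E,
        (∀ n, T n R ∈ gammaRadonifying (L2Interval a b H) F) ∧
        T₀ R ∈ gammaRadonifying (L2Interval a b H) F ∧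
        Tendsto (fun n => T n R) atTop (𝓝 (T₀ R)) := by
  obtain ⟨C, hC⟩ : ∃ C : ℝ≥0, ∀ n, IsGammaBoundedWith (M n '' Ioo a b) C := by
    obtain ⟨C, hC, -⟩ := ENNReal.lt_iff_exists_nnreal_btwn.1 hγ_sup
    exact ⟨C, fun n => isGammaBoundedWith_of_gammaBound_lt ((le_iSup _ n).trans_lt hC)⟩
  have hC₀ : IsGammaBoundedWith (M₀ '' Ioo a b) C :=
    IsGammaBoundedWith.image_of_tendsto hC fun t ht x =>
      (hconv x {t} (singleton_subset_iff.2 ht) isCompact_singleton).tendsto_at rfl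
  have hcont := fun n x => (hM n x).continuousOn
  have hcont₀ := fun x => (hM₀ x).continuousOn
  choose S hSbound hS using fun n => exists_multipliesRankOne (H := H) hab (hC n) (hcont n)
  obtain ⟨S₀, hS₀bound, hS₀⟩ := exists_multipliesRankOne (H := H) hab hC₀ hcont₀
  have hSmul := fun n => (hS n).isMultiplicationOperator (hC n) (hcont n)
  have hS₀mul := hS₀.isMultiplicationOperator hC₀ hcont₀
  refine ⟨fun n => ⟨S n, hSmul n, fun T hT => hT.unique (hSmul n)⟩,
    ⟨S₀, hS₀mul, fun T hT => hT.unique hS₀mul⟩, fun T T₀ hT hT₀ R => ?_⟩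
  -- By uniqueness the given operators are the constructed ones, so the norm bounds and rank one
  -- formulas become available.
  obtain rfl : T = S := funext fun n => (hT n).unique (hSmul n)
  obtain rfl : T₀ = S₀ := hT₀.unique hS₀mul
  refine ⟨fun n => (hS n).mem_gammaRadonifying hab (hM n) R, hS₀.mem_gammaRadonifying hab hM₀ R, ?_⟩
  have hbound : ∀ n R, ‖(T n - T₀) R‖ ≤ (2 * C : ℝ≥0) * ‖R‖ := fun n R => by
    rw [sub_apply]
    refine (norm_sub_le _ _).trans ((add_le_add (hSbound n R) (hS₀bound R)).trans (le_of_eq ?_))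
    push_cast
    ring
  have hdiff := fun n => MultipliesRankOne.sub (hC n) (hcont n) hC₀ hcont₀ (hS n) hS₀
  refine tendsto_sub_nhds_zero_iff.1 (tendsto_zero_of_gammaRankOne hbound (fun g x => ?_) R)
  refine L2Interval.mem_of_compactSupport_mem hab
    (S := {g | Tendsto (fun n => ((T n - T₀).comp ((gammaRankOne _ _).flip x)) g) atTop (𝓝 0)})
    (isClosed_setOf_tendsto_zero (K := 2 * C * ‖x‖₊) fun n g => ?_) g fun c d hc hcd hd => ?_
  · refine (hbound n _).trans ?_
    rw [NNReal.coe_mul _ ‖x‖₊, mul_assoc]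
    gcongr
    rw [mul_comm]
    exact norm_gammaRankOne_le g x
  · have hsub : Icc c d ⊆ Ioo a b := Icc_subset_Ioo hc hd
    refine Metric.tendsto_nhds.2 fun η hη => ?_
    set K := ‖g‖ * (1 + (d - c)) with hK
    have hK0 : 0 ≤ K := mul_nonneg (norm_nonneg _) (by linarith)
    -- Dividing by `K + 1` allows `K = 0` and makes the final bound `K * η / (K + 1)` strictly less
    -- than `η`.
    have hε : 0 < η / (K + 1) := by positivity
    filter_upwards [Metric.tendstoUniformlyOn_iff.1 (hconv x _ hsub isCompact_Icc) _ hε,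
      Metric.tendstoUniformlyOn_iff.1 (hconv' x _ hsub isCompact_Icc) _ hε] with n h0 h1
    obtain ⟨Q, hQ, hQn⟩ := exists_gammaRadonifying_of_contDiffOn
      (m := fun t => (M n t - M₀ t) x) (ε := η / (K + 1)) ((hM n x).sub (hM₀ x)) hc hcd hd
      (by simpa [dist_eq_norm'] using (h0 c ⟨le_rfl, hcd⟩).le) (fun t ht => by
        have hd1 := ((hM n x).differentiableOn one_ne_zero).differentiableAt
          (isOpen_Ioo.mem_nhds (hsub ht))
        have hd2 := ((hM₀ x).differentiableOn one_ne_zero).differentiableAt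
          (isOpen_Ioo.mem_nhds (hsub ht))
        have h2 := (hd1.hasDerivAt.sub hd2.hasDerivAt).deriv
        have h3 : deriv (fun t => (M n t - M₀ t) x) t
            = deriv (fun s => M n s x) t - deriv (fun s => M₀ s x) t := h2
        rw [h3, ← dist_eq_norm']
        exact (h1 t ht).le) g
    have hTQ : ((T n - T₀).comp ((gammaRankOne _ _).flip x))
        (lpIndicator _ H (measurableSet_Icc (a := c) (b := d)) g) = Q.1 :=
      GammaSumming.ext_apply fun u => by rw [hQ]; exact hdiff n _ x u
    rw [hTQ, dist_zero_right]
    refine (show ‖Q.1‖ ≤ _ from hQn).trans_lt ?_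
    rw [← hK, mul_div_assoc', div_lt_iff₀ (by positivity)]
    nlinarith
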